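/- Conventions. All algebras are over a field $\Bbbk$ and need not be unital; $\otimes=\otimes_{\Bbbk}$. For a nondegenerate algebra $R$, $M(R)$ is its multiplier algebra: the pairs $(X,X')$ of linear endomorphisms of $R$ with $aX(b)=X'(a)b$ for all $a,b\in R$. A multiplier bialgebra is a nondegenerate algebra $C$ with a nondegenerate homomorphism $\Delta\colon C\to M(C\otimes C)$ such that $\Delta(C)(1\otimes C)$, $\Delta(C)(C\otimes 1)$, $(C\otimes 1)\Delta(C)$, $(1\otimes C)\Delta(C)$ are contained in $C\otimes C$ and $(\Delta\otimes\iota)\Delta=(\iota\otimes\Delta)\Delta$. It is a multiplier Hopf algebra if $a\otimes b\mapsto\Delta(a)(1\otimes b)$ and $a\otimes b\mapsto(a\otimes 1)\Delta(b)$ are bijections of $C\otimes C$; it is regular if $(C,\sigma\Delta)$, with $\sigma$ the flip, is one as well. A multiplier Hopf algebra has a unique counit $\varepsilon$. A multiplier bialgebra $C$ is counitary, with counit $\varepsilon\colon C\to\Bbbk$, if $\varepsilon$ is a homomorphism with $(\varepsilon\otimes\iota)\Delta=\iota=(\iota\otimes\varepsilon)\Delta$. A subalgebra $B\subseteq C$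 is a multiplier Hopf subalgebra (resp. multiplier subbialgebra) if $\Delta$ restricts to $\Delta_B\colon B\to M(B\otimes B)$ and $(B,\Delta_B)$ is a multiplier Hopf algebra (resp. multiplier bialgebra). Nondegenerate homomorphisms, in particular $\Delta_A$ and $\varepsilon_A$, are extended to multiplier algebras. Proposition. Let $A$ and $Y$ be regular multiplier Hopf algebras with $A$ commutative, and let $h\in M(A)$ satisfy $$\varepsilon_A(h)=1,\qquad h\otimes h=(h\otimes 1)\Delta_A(h)=(1\otimes h)\Delta_A(h).$$ Consider the coaction $\rho\colon Y\to M(A\otimes Y)$, $\rho(y)=h\otimes y$, and $T\colon Y\otimes A\to A\otimes Y$, $T(y\otimes a)=\rho(y)(a\otimes 1)$. Let $Y\rtimes A$ be the algebra $Y\otimes A$ with the comultiplication $\overline\Delta\colon Y\otimes A\to M((Y\otimes A)\otimes(Y\otimes A))$ given by $$\overline\Delta(y\otimes a)\bigl((y'\otimes a')\otimes(y''\otimes a'')\bigr)=(\iota\otimes T\otimes\iota)\bigl(\Delta_Y(y)(y'\otimes 1)\otimes\Delta_A(a)(1\otimes a'')\bigr)(1\otimes a'\otimes y''\otimes 1),$$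 $$\bigl((y'\otimes a')\otimes(y''\otimes a'')\bigr)\overline\Delta(y\otimes a)=(1\otimes a'\otimes y''\otimes 1)(\iota\otimes T\otimes\iota)\bigl((y'\otimes 1)\Delta_Y(y)\otimes(1\otimes a'')\Delta_A(a)\bigr),$$ let $\overline\varepsilon=\varepsilon_Y\otimes\varepsilon_A$, and let the partial smash coproduct $\overline{Y\rtimes A}=(\iota_Y\otimes\iota_A\otimes\overline\varepsilon)\overline\Delta(Y\rtimes A)\subseteq Y\otimes A$ be the linear span of the elements $(\iota_Y\otimes\iota_A\otimes\overline\varepsilon)(\overline\Delta(x)(1\otimes b))$ with $x,b\in Y\otimes A$, $\overline\varepsilon(b)=1$. Then $\overline\Delta$ is well defined by these formulas, and: 1. $hA$ is a multiplier Hopf subalgebra of $A$. 2. $\overline{Y\rtimes A}$ is a subalgebra of $Y\otimes A$, $\overline\Delta$ restricts to it, and it is with this comultiplication and the restriction of $\overline\varepsilon$ a counitary multiplier bialgebra. So is $Y\otimes hA$ with the tensor product comultiplication $(\iota_Y\otimes\tau\otimes\iota_{hA})(\Delta_Y\otimes\Delta_{hA})$, $\tau$ the flip of the two middle factors, and the counit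 $\varepsilon_Y\otimes\varepsilon_{hA}$; and $\overline{Y\rtimes A}\simeq Y\otimes hA$ as counitary multiplier bialgebras, i.e. there is an algebra isomorphism that intertwines the comultiplications and the counits. -/

import Mathlib

open scoped TensorProduct

noncomputable section

namespace MultHopf

/-! ### Multiplier algebras -/

section Multipliers

variable (k : Type*) [Field k]

/-- Left and right nondegeneracy of the product of a (not necessarily unital) algebra. -/
def IsNondegenerateAlg (R : Type*) [NonUnitalRing R] : Prop :=
  (∀ a : R, (∀ b : R, a * b = 0) → a = 0) ∧ (∀ b : R, (∀ a : R, a * b = 0) → b = 0)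

variable (R : Type*) [NonUnitalRing R] [Module k R] [SMulCommClass k R R] [IsScalarTower k R R]
variable (S : Type*) [NonUnitalRing S] [Module k S] [SMulCommClass k S S] [IsScalarTower k S S]

/-- The multiplier algebra `M(R)`: the pairs `(X, X')` of linear endomorphisms of `R` with
`a * X b = X' a * b` for all `a, b`. The product is `(X, X') (Z, Z') = (X ∘ Z, Z' ∘ X')`
and the unit is the pair of identities. -/
def multiplierSubalgebra : Subalgebra k (Module.End k R × (Module.End k R)ᵐᵒᵖ) where
  carrier := {p | ∀ a b : R, a * p.1 b = p.2.unop a * b}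
  mul_mem' := by
    intro p q hp hq a b
    simp only [Set.mem_ofPred_eq] at hp hq
    simp [Module.End.mul_apply, hp, hq]
  add_mem' := by
    intro p q hp hq a b
    simp only [Set.mem_ofPred_eq] at hp hq
    simp [mul_add, add_mul, hp, hq]
  algebraMap_mem' := by
    intro r a b
    simp [Algebra.algebraMap_eq_smul_one, mul_smul_comm, smul_mul_assoc]

/-- The multiplier algebra `M(R)` as a type. -/
def Mult : Type _ := ↥(multiplierSubalgebra k R)

instance : Ring (Mult k R) := inferInstanceAs (Ring ↥(multiplierSubalgebra k R))

instance : Algebra k (Mult k R) := inferInstanceAs (Algebra k ↥(multiplierSubalgebra k R))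

variable {k R S}

namespace Mult

/-- `m.left a` is `m a`. -/
def left (m : Mult k R) : R →ₗ[k] R := m.1.1

/-- `m.right a` is `a m`. -/
def right (m : Mult k R) : R →ₗ[k] R := m.1.2.unop

/-- A multiplier from its two components. -/
def mk (l r : R →ₗ[k] R) (H : ∀ a b : R, a * l b = r a * b) : Mult k R :=
  ⟨(l, MulOpposite.op r), H⟩

theorem central (m : Mult k R) (a b : R) : a * m.left b = m.right a * b := m.2 a b

theorem ext' {m n : Mult k R} (hl : ∀ a, m.left a = n.left a) (hr : ∀ a, m.right a = n.right a) :
    m = n := by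
  apply Subtype.ext
  apply Prod.ext
  · exact LinearMap.ext hl
  · exact MulOpposite.unop_injective (LinearMap.ext hr)

@[simp] theorem left_mk (l r : R →ₗ[k] R) (H) (a : R) : (mk l r H).left a = l a := rfl
@[simp] theorem right_mk (l r : R →ₗ[k] R) (H) (a : R) : (mk l r H).right a = r a := rfl
@[simp] theorem left_mul (m n : Mult k R) (a : R) : (m * n).left a = m.left (n.left a) := rfl
@[simp] theorem right_mul (m n : Mult k R) (a : R) : (m * n).right a = n.right (m.right a) := rfl
@[simp] theorem left_one (a : R) : (1 : Mult k R).left a = a := rfl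
@[simp] theorem right_one (a : R) : (1 : Mult k R).right a = a := rfl
@[simp] theorem left_add (m n : Mult k R) (a : R) : (m + n).left a = m.left a + n.left a := rfl
@[simp] theorem right_add (m n : Mult k R) (a : R) : (m + n).right a = m.right a + n.right a := rfl
@[simp] theorem left_smul (c : k) (m : Mult k R) (a : R) : (c • m).left a = c • m.left a := rfl
@[simp] theorem right_smul (c : k) (m : Mult k R) (a : R) : (c • m).right a = c • m.right a := rfl

/-- The canonical map `R → M(R)`, `a ↦ (left multiplication, right multiplication)`. -/
def incl : R →ₗ[k] Mult k R where
  toFun a := mk (LinearMap.mulLeft k a) (LinearMap.mulRight k a)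
    (fun b c => by simp [mul_assoc])
  map_add' a b := by
    apply ext' <;> intro c
    · exact add_mul a b c
    · exact mul_add c a b
  map_smul' r a := by
    apply ext' <;> intro c
    · exact smul_mul_assoc r a c
    · exact mul_smul_comm r c a

/-- The multiplier `m ⊗ n` of `R ⊗ S`. -/
def tmul : Mult k R →ₗ[k] Mult k S →ₗ[k] Mult k (R ⊗[k] S) :=
  LinearMap.mk₂ k
    (fun m n => mk (TensorProduct.map m.left n.left) (TensorProduct.map m.right n.right) (by
      intro x y
      induction x using TensorProduct.induction_on with
      | zero => simp
      | add x x' hx hx' => simp only [add_mul, map_add, hx, hx']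
      | tmul a b =>
        induction y using TensorProduct.induction_on with
        | zero => simp
        | add y y' hy hy' => simp only [mul_add, map_add, hy, hy']
        | tmul c d => simp [central]))
    (by
      intro m m' n
      apply ext' <;> intro x <;>
        induction x using TensorProduct.induction_on <;>
        simp_all [TensorProduct.add_tmul, add_add_add_comm])
    (by
      intro c m n
      apply ext' <;> intro x <;>
        induction x using TensorProduct.induction_on <;>
        simp_all [TensorProduct.smul_tmul'])
    (by
      intro m n n'
      apply ext' <;> intro x <;>
        induction x using TensorProduct.induction_on <;>
        simp_all [TensorProduct.tmul_add, add_add_add_comm])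
    (by
      intro c m n
      apply ext' <;> intro x <;>
        induction x using TensorProduct.induction_on <;>
        simp_all [TensorProduct.tmul_smul])

/-- Transport of multipliers along an isomorphism of algebras. -/
def congr (e : R ≃ₗ[k] S) (he : ∀ x y, e (x * y) = e x * e y) : Mult k R →ₗ[k] Mult k S where
  toFun m := mk (e.toLinearMap ∘ₗ m.left ∘ₗ e.symm.toLinearMap)
    (e.toLinearMap ∘ₗ m.right ∘ₗ e.symm.toLinearMap) (by
      intro a b
      have H := congrArg e (m.central (e.symm a) (e.symm b))
      rw [he, he] at H
      simpa using H)
  map_add' m n := by apply ext' <;> intro a <;> simp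
  map_smul' c m := by apply ext' <;> intro a <;> simp

/-- `IsExtension φ m n`: the multiplier `n` is the value at `m ∈ M(R)` of the extension of
`φ : R → M(S)` to `M(R)`, i.e. `n φ(r) = φ(m r)` and `φ(r) n = φ(r m)` for all `r ∈ R`.
If `φ` is a nondegenerate homomorphism there is exactly one such `n`, and `m ↦ n` is the unique
unital homomorphism `M(R) → M(S)` extending `φ`. -/
def IsExtension (φ : R →ₗ[k] Mult k S) (m : Mult k R) (n : Mult k S) : Prop :=
  ∀ r : R, n * φ r = φ (m.left r) ∧ φ r * n = φ (m.right r)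

open Classical in
/-- The extension of a nondegenerate homomorphism `φ : R → M(S)` to `M(R)`. -/
def extend (φ : R →ₗ[k] Mult k S) (m : Mult k R) : Mult k S :=
  if H : ∃ n, IsExtension φ m n then H.choose else 0

open Classical in
/-- For a linear map `f : V → M(R)` with values in `R ⊆ M(R)`, the same map seen as a map
`V → R`. It is unique, since `R → M(R)` is injective for a nondegenerate algebra `R`. -/
def corestrict {V : Type*} [AddCommGroup V] [Module k V] (f : V →ₗ[k] Mult k R) : V →ₗ[k] R :=
  if H : ∃ g : V →ₗ[k] R, ∀ v, incl (g v) = f v then H.choose else 0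

/-- For a multiplier `h` of a nondegenerate algebra `R`, the subalgebra `h R` of `R`. -/
def leftIdeal (hR : IsNondegenerateAlg R) (h : Mult k R) : NonUnitalSubalgebra k R where
  carrier := {x | ∃ a, x = h.left a}
  add_mem' := by
    rintro _ _ ⟨a, rfl⟩ ⟨b, rfl⟩
    exact ⟨a + b, by simp⟩
  zero_mem' := ⟨0, by simp⟩
  smul_mem' := by
    rintro c _ ⟨a, rfl⟩
    exact ⟨c • a, by simp⟩
  mul_mem' := by
    rintro _ _ ⟨a, rfl⟩ ⟨b, rfl⟩
    refine ⟨a * h.left b, ?_⟩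
    rw [← sub_eq_zero]
    refine hR.2 _ fun c => ?_
    rw [mul_sub, ← mul_assoc, h.central c a, h.central c (a * h.left b), mul_assoc, sub_self]

end Mult

end Multipliers

/-! ### Multiplier bialgebras and multiplier Hopf algebras -/

section Bialgebras

open Mult

variable {k : Type*} [Field k]
variable {A : Type*} [NonUnitalRing A] [Module k A] [SMulCommClass k A A] [IsScalarTower k A A]
variable {B : Type*} [NonUnitalRing B] [Module k B] [SMulCommClass k B B] [IsScalarTower k B B]
variable {Y : Type*} [NonUnitalRing Y] [Module k Y] [SMulCommClass k Y Y] [IsScalarTower k Y Y]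

/-- `a ↦ a ⊗ 1 ∈ M(A ⊗ B)`. -/
def fst (B : Type*) [NonUnitalRing B] [Module k B] [SMulCommClass k B B] [IsScalarTower k B B] :
    A →ₗ[k] Mult k (A ⊗[k] B) := (tmul (k := k) (R := A) (S := B)).flip 1 ∘ₗ incl

/-- `b ↦ 1 ⊗ b ∈ M(A ⊗ B)`. -/
def snd (A : Type*) [NonUnitalRing A] [Module k A] [SMulCommClass k A A] [IsScalarTower k A A] :
    B →ₗ[k] Mult k (A ⊗[k] B) := tmul (k := k) (R := A) (S := B) 1 ∘ₗ incl

/-- The linear map `v ⊗ w ↦ f(v) g(w)` into a multiplier algebra. -/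
def prodMap {V W : Type*} [AddCommGroup V] [Module k V] [AddCommGroup W] [Module k W]
    (f : V →ₗ[k] Mult k A) (g : W →ₗ[k] Mult k A) : V ⊗[k] W →ₗ[k] Mult k A :=
  TensorProduct.lift ((LinearMap.mul k (Mult k A)).compl₁₂ f g)

/-- `T₁(a ⊗ b) = Δ(a)(1 ⊗ b)`. -/
def T₁ (Δ : A →ₗ[k] Mult k (A ⊗[k] A)) : A ⊗[k] A →ₗ[k] A ⊗[k] A :=
  corestrict (prodMap Δ (snd A))

/-- `T₂(a ⊗ b) = (a ⊗ 1)Δ(b)`. -/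
def T₂ (Δ : A →ₗ[k] Mult k (A ⊗[k] A)) : A ⊗[k] A →ₗ[k] A ⊗[k] A :=
  corestrict (prodMap (fst A) Δ)

/-- `T₃(a ⊗ b) = Δ(a)(b ⊗ 1)`. -/
def T₃ (Δ : A →ₗ[k] Mult k (A ⊗[k] A)) : A ⊗[k] A →ₗ[k] A ⊗[k] A :=
  corestrict (prodMap Δ (fst A))

/-- `T₄(a ⊗ b) = (1 ⊗ a)Δ(b)`. -/
def T₄ (Δ : A →ₗ[k] Mult k (A ⊗[k] A)) : A ⊗[k] A →ₗ[k] A ⊗[k] A :=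
  corestrict (prodMap (snd A) Δ)

theorem assoc_mul (x y : (A ⊗[k] B) ⊗[k] Y) :
    TensorProduct.assoc k A B Y (x * y) =
      TensorProduct.assoc k A B Y x * TensorProduct.assoc k A B Y y := by
  induction x using TensorProduct.induction_on with
  | zero => simp
  | add x x' hx hx' => simp only [add_mul, map_add, hx, hx']
  | tmul p c =>
    induction p using TensorProduct.induction_on with
    | zero => simp
    | add p p' hp hp' => simp only [TensorProduct.add_tmul, add_mul, map_add, hp, hp']
    | tmul a b =>
      induction y using TensorProduct.induction_on with
      | zero => simp
      | add y y' hy hy' => simp only [mul_add, map_add, hy, hy']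
      | tmul q c' =>
        induction q using TensorProduct.induction_on with
        | zero => simp
        | add q q' hq hq' => simp only [TensorProduct.add_tmul, mul_add, map_add, hq, hq']
        | tmul a' b' => simp

theorem comm_mul (x y : A ⊗[k] B) :
    TensorProduct.comm k A B (x * y) = TensorProduct.comm k A B x * TensorProduct.comm k A B y := by
  induction x using TensorProduct.induction_on with
  | zero => simp
  | add x x' hx hx' => simp only [add_mul, map_add, hx, hx']
  | tmul a b =>
    induction y using TensorProduct.induction_on with
    | zero => simp
    | add y y' hy hy' => simp only [mul_add, map_add, hy, hy']
    | tmul a' b' => simp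

theorem tensorTensorTensorComm_mul (x y : (Y ⊗[k] Y) ⊗[k] (B ⊗[k] B)) :
    TensorProduct.tensorTensorTensorComm k Y Y B B (x * y) =
      TensorProduct.tensorTensorTensorComm k Y Y B B x *
        TensorProduct.tensorTensorTensorComm k Y Y B B y := by
  induction x using TensorProduct.induction_on with
  | zero => simp
  | add x x' hx hx' => simp only [add_mul, map_add, hx, hx']
  | tmul p q =>
    induction p using TensorProduct.induction_on with
    | zero => simp
    | add p p' hp hp' => simp only [TensorProduct.add_tmul, add_mul, map_add, hp, hp']
    | tmul a b =>
      induction q using TensorProduct.induction_on with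
      | zero => simp
      | add q q' hq hq' => simp only [TensorProduct.tmul_add, add_mul, map_add, hq, hq']
      | tmul c d =>
        induction y using TensorProduct.induction_on with
        | zero => simp
        | add y y' hy hy' => simp only [mul_add, map_add, hy, hy']
        | tmul p q =>
          induction p using TensorProduct.induction_on with
          | zero => simp
          | add p p' hp hp' => simp only [TensorProduct.add_tmul, mul_add, map_add, hp, hp']
          | tmul a' b' =>
            induction q using TensorProduct.induction_on with
            | zero => simp
            | add q q' hq hq' => simp only [TensorProduct.tmul_add, mul_add, map_add, hq, hq']
            | tmul c' d' => simp

/-- `Δ ⊗ ι : A ⊗ A → M((A ⊗ A) ⊗ A)`. -/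
def comulId (Δ : A →ₗ[k] Mult k (A ⊗[k] A)) : A ⊗[k] A →ₗ[k] Mult k ((A ⊗[k] A) ⊗[k] A) :=
  TensorProduct.lift (tmul.compl₁₂ Δ incl)

/-- `ι ⊗ Δ : A ⊗ A → M(A ⊗ (A ⊗ A))`. -/
def idComul (Δ : A →ₗ[k] Mult k (A ⊗[k] A)) : A ⊗[k] A →ₗ[k] Mult k (A ⊗[k] (A ⊗[k] A)) :=
  TensorProduct.lift (tmul.compl₁₂ incl Δ)

/-- `(A, Δ)` is a multiplier bialgebra. -/
structure IsMultiplierBialgebra (Δ : A →ₗ[k] Mult k (A ⊗[k] A)) : Prop where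
  nondegenerate : IsNondegenerateAlg A
  /-- `Δ` is a homomorphism ... -/
  map_mul : ∀ a b, Δ (a * b) = Δ a * Δ b
  /-- ... which is nondegenerate: `Δ(A)(A ⊗ A)` and `(A ⊗ A)Δ(A)` span `A ⊗ A`. -/
  span_left : Submodule.span k {z | ∃ a x, z = (Δ a).left x} = ⊤
  span_right : Submodule.span k {z | ∃ a x, z = (Δ a).right x} = ⊤
  /-- `Δ(A)(1 ⊗ A)`, `(A ⊗ 1)Δ(A)`, `Δ(A)(A ⊗ 1)` and `(1 ⊗ A)Δ(A)` are contained in `A ⊗ A`. -/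
  cover₁ : ∀ a b, ∃ x : A ⊗[k] A, incl x = Δ a * snd A b
  cover₂ : ∀ a b, ∃ x : A ⊗[k] A, incl x = fst A a * Δ b
  cover₃ : ∀ a b, ∃ x : A ⊗[k] A, incl x = Δ a * fst A b
  cover₄ : ∀ a b, ∃ x : A ⊗[k] A, incl x = snd A a * Δ b
  /-- Coassociativity `(Δ ⊗ ι)Δ = (ι ⊗ Δ)Δ`, multiplied by `a ⊗ 1 ⊗ 1` from the left and by
  `1 ⊗ 1 ⊗ c` from the right:
  `(a ⊗ 1 ⊗ 1)(Δ ⊗ ι)(Δ(b)(1 ⊗ c)) = (ι ⊗ Δ)((a ⊗ 1)Δ(b))(1 ⊗ 1 ⊗ c)`. -/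
  coassoc : ∀ a b c : A,
    Mult.congr (TensorProduct.assoc k A A A) assoc_mul
        (tmul (fst A a) 1 * comulId Δ (T₁ Δ (b ⊗ₜ c))) =
      idComul Δ (T₂ Δ (a ⊗ₜ b)) * tmul 1 (snd A c)

/-- `(A, Δ)` is a multiplier Hopf algebra. -/
structure IsMultiplierHopf (Δ : A →ₗ[k] Mult k (A ⊗[k] A)) : Prop
    extends IsMultiplierBialgebra Δ where
  bijective_T₁ : Function.Bijective (T₁ Δ)
  bijective_T₂ : Function.Bijective (T₂ Δ)

/-- The flipped coproduct `σ Δ`. -/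
def flipComul (Δ : A →ₗ[k] Mult k (A ⊗[k] A)) : A →ₗ[k] Mult k (A ⊗[k] A) :=
  Mult.congr (TensorProduct.comm k A A) comm_mul ∘ₗ Δ

/-- `(A, Δ)` is a regular multiplier Hopf algebra. -/
structure IsRegularMultiplierHopf (Δ : A →ₗ[k] Mult k (A ⊗[k] A)) : Prop
    extends IsMultiplierHopf Δ where
  flip : IsMultiplierHopf (flipComul Δ)

/-- `ε ⊗ ι : A ⊗ B → B`. -/
def counitLeft (ε : A →ₗ[k] k) : A ⊗[k] B →ₗ[k] B :=
  (TensorProduct.lid k B).toLinearMap ∘ₗ TensorProduct.map ε LinearMap.id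

/-- `ι ⊗ ε : A ⊗ B → A`. -/
def counitRight (ε : B →ₗ[k] k) : A ⊗[k] B →ₗ[k] A :=
  (TensorProduct.rid k A).toLinearMap ∘ₗ TensorProduct.map LinearMap.id ε

/-- The equations `(ε ⊗ ι)(Δ(a)(1 ⊗ b)) = ab` and `(ι ⊗ ε)((a ⊗ 1)Δ(b)) = ab` that determine the
counit of a multiplier Hopf algebra. -/
def IsHopfCounit (Δ : A →ₗ[k] Mult k (A ⊗[k] A)) (ε : A →ₗ[k] k) : Prop :=
  ∀ a b : A, counitLeft ε (T₁ Δ (a ⊗ₜ b)) = a * b ∧ counitRight ε (T₂ Δ (a ⊗ₜ b)) = a * b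

open Classical in
/-- The counit of a multiplier Hopf algebra (there is exactly one). -/
def counit (Δ : A →ₗ[k] Mult k (A ⊗[k] A)) : A →ₗ[k] k :=
  if H : ∃ ε, IsHopfCounit Δ ε then H.choose else 0

/-- `(A, Δ)` is a counitary multiplier bialgebra with counit `ε`: `ε` is a homomorphism and
`(ε ⊗ ι)Δ(a) = a`, `(ι ⊗ ε)Δ(a) = a` as multipliers of `A` (both components). -/
structure IsCounitaryMultiplierBialgebra (Δ : A →ₗ[k] Mult k (A ⊗[k] A)) (ε : A →ₗ[k] k) : Prop
    extends IsMultiplierBialgebra Δ where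
  counit_mul : ∀ a b, ε (a * b) = ε a * ε b
  left_counit : ∀ a b : A,
    counitLeft ε (T₁ Δ (a ⊗ₜ b)) = a * b ∧ counitLeft ε (T₄ Δ (b ⊗ₜ a)) = b * a
  right_counit : ∀ a b : A,
    counitRight ε (T₃ Δ (a ⊗ₜ b)) = a * b ∧ counitRight ε (T₂ Δ (b ⊗ₜ a)) = b * a

/-- `(A, Δ, ε)` and `(B, Δ', ε')` are isomorphic as counitary multiplier bialgebras: there is an
isomorphism of algebras `Φ` with `(Φ ⊗ Φ)Δ = Δ'Φ` and `ε'Φ = ε`. -/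
def CounitaryIsomorphic (Δ : A →ₗ[k] Mult k (A ⊗[k] A)) (ε : A →ₗ[k] k)
    (Δ' : B →ₗ[k] Mult k (B ⊗[k] B)) (ε' : B →ₗ[k] k) : Prop :=
  ∃ Φ : A ≃ₗ[k] B, (∀ a b, Φ (a * b) = Φ a * Φ b) ∧
    (∀ a x, TensorProduct.congr Φ Φ ((Δ a).left x) =
      (Δ' (Φ a)).left (TensorProduct.congr Φ Φ x)) ∧
    (∀ a x, TensorProduct.congr Φ Φ ((Δ a).right x) =
      (Δ' (Φ a)).right (TensorProduct.congr Φ Φ x)) ∧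
    ∀ a, ε' (Φ a) = ε a

/-- The inclusion of a subalgebra. -/
def inclusion (S : NonUnitalSubalgebra k A) : S →ₗ[k] A where
  toFun x := x
  map_add' _ _ := rfl
  map_smul' _ _ := rfl

/-- `Δ_S : S → M(S ⊗ S)` is the restriction of `Δ` to the subalgebra `S`: the multipliers `Δ(s)`
of `A ⊗ A`, `s ∈ S`, map `S ⊗ S ⊆ A ⊗ A` to itself, and they act on it as `Δ_S(s)`. -/
def IsRestriction (Δ : A →ₗ[k] Mult k (A ⊗[k] A)) (S : NonUnitalSubalgebra k A)
    (ΔS : S →ₗ[k] Mult k (S ⊗[k] S)) : Prop :=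
  ∀ (s : S) (x : S ⊗[k] S),
    TensorProduct.map (inclusion S) (inclusion S) ((ΔS s).left x) =
      (Δ s).left (TensorProduct.map (inclusion S) (inclusion S) x) ∧
    TensorProduct.map (inclusion S) (inclusion S) ((ΔS s).right x) =
      (Δ s).right (TensorProduct.map (inclusion S) (inclusion S) x)

open Classical in
/-- The restriction of `Δ` to a subalgebra (unique if it exists). -/
def restrictComul (Δ : A →ₗ[k] Mult k (A ⊗[k] A)) (S : NonUnitalSubalgebra k A) :
    S →ₗ[k] Mult k (S ⊗[k] S) :=
  if H : ∃ ΔS, IsRestriction Δ S ΔS then H.choose else 0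

/-- `S` is a multiplier Hopf subalgebra of `(A, Δ)`. -/
def IsMultiplierHopfSubalgebra (Δ : A →ₗ[k] Mult k (A ⊗[k] A)) (S : NonUnitalSubalgebra k A) :
    Prop :=
  IsRestriction Δ S (restrictComul Δ S) ∧ IsMultiplierHopf (restrictComul Δ S)

/-- The coproduct `(ι ⊗ τ ⊗ ι)(Δ_Y ⊗ Δ_B)` of the tensor product `Y ⊗ B`. -/
def tensorComul (ΔY : Y →ₗ[k] Mult k (Y ⊗[k] Y)) (ΔB : B →ₗ[k] Mult k (B ⊗[k] B)) :
    Y ⊗[k] B →ₗ[k] Mult k ((Y ⊗[k] B) ⊗[k] (Y ⊗[k] B)) :=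
  Mult.congr (TensorProduct.tensorTensorTensorComm k Y Y B B) tensorTensorTensorComm_mul ∘ₗ
    TensorProduct.lift (tmul.compl₁₂ ΔY ΔB)

/-- The linear form `y ⊗ b ↦ ε_Y(y) ε_B(b)` on `Y ⊗ B`. -/
def tensorCounit (εY : Y →ₗ[k] k) (εB : B →ₗ[k] k) : Y ⊗[k] B →ₗ[k] k :=
  LinearMap.mul' k k ∘ₗ TensorProduct.map εY εB

/-! ### The partial smash coproduct -/

/-- For `ρ : Y → M(A ⊗ Y)` with `ρ(Y)(A ⊗ 1) ⊆ A ⊗ Y`, the map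
`T : Y ⊗ A → A ⊗ Y`, `T(y ⊗ a) = ρ(y)(a ⊗ 1)`. -/
def coactionT (ρ : Y →ₗ[k] Mult k (A ⊗[k] Y)) : Y ⊗[k] A →ₗ[k] A ⊗[k] Y :=
  corestrict (prodMap ρ (fst Y))

/-- `ι ⊗ T ⊗ ι`, as a map from `(Y ⊗ Y) ⊗ (A ⊗ A)` to `(Y ⊗ A) ⊗ (Y ⊗ A)`. -/
def midT (T : Y ⊗[k] A →ₗ[k] A ⊗[k] Y) :
    (Y ⊗[k] Y) ⊗[k] (A ⊗[k] A) →ₗ[k] (Y ⊗[k] A) ⊗[k] (Y ⊗[k] A) :=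
  (TensorProduct.assoc k Y A (Y ⊗[k] A)).symm.toLinearMap ∘ₗ
    TensorProduct.map LinearMap.id ((TensorProduct.assoc k A Y A).toLinearMap ∘ₗ
      TensorProduct.map T LinearMap.id ∘ₗ (TensorProduct.assoc k Y A A).symm.toLinearMap) ∘ₗ
    (TensorProduct.assoc k Y Y (A ⊗[k] A)).toLinearMap

/-- The defining formulas of the comultiplication `D` on the smash coproduct `Y ⊗ A`:
`D(y ⊗ a)((y' ⊗ a') ⊗ (y'' ⊗ a''))
  = (ι ⊗ T ⊗ ι)(Δ_Y(y)(y' ⊗ 1) ⊗ Δ_A(a)(1 ⊗ a'')) (1 ⊗ a' ⊗ y'' ⊗ 1)` and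
`((y' ⊗ a') ⊗ (y'' ⊗ a''))D(y ⊗ a)
  = (1 ⊗ a' ⊗ y'' ⊗ 1) (ι ⊗ T ⊗ ι)((y' ⊗ 1)Δ_Y(y) ⊗ (1 ⊗ a'')Δ_A(a))`,
i.e. `D(y ⊗ a) = y₍₁₎ ⊗ T(y₍₂₎ ⊗ a₍₁₎) ⊗ a₍₂₎` in Sweedler notation. -/
def IsSmashComul (ΔY : Y →ₗ[k] Mult k (Y ⊗[k] Y)) (ΔA : A →ₗ[k] Mult k (A ⊗[k] A))
    (ρ : Y →ₗ[k] Mult k (A ⊗[k] Y))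
    (D : Y ⊗[k] A →ₗ[k] Mult k ((Y ⊗[k] A) ⊗[k] (Y ⊗[k] A))) : Prop :=
  ∀ (y y' y'' : Y) (a a' a'' : A),
    (D (y ⊗ₜ a)).left ((y' ⊗ₜ a') ⊗ₜ (y'' ⊗ₜ a'')) =
      (tmul (snd Y a') (fst A y'')).right
        (midT (coactionT ρ) (T₃ ΔY (y ⊗ₜ y') ⊗ₜ T₁ ΔA (a ⊗ₜ a''))) ∧
    (D (y ⊗ₜ a)).right ((y' ⊗ₜ a') ⊗ₜ (y'' ⊗ₜ a'')) =
      (tmul (snd Y a') (fst A y'')).left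
        (midT (coactionT ρ) (T₂ ΔY (y' ⊗ₜ y) ⊗ₜ T₄ ΔA (a'' ⊗ₜ a)))

open Classical in
/-- The comultiplication of the smash coproduct `Y ⋊ A` with respect to `ρ : Y → M(A ⊗ Y)`;
the underlying algebra is `Y ⊗ A`. It is determined by its defining formulas. -/
def smashComul (ΔY : Y →ₗ[k] Mult k (Y ⊗[k] Y)) (ΔA : A →ₗ[k] Mult k (A ⊗[k] A))
    (ρ : Y →ₗ[k] Mult k (A ⊗[k] Y)) :
    Y ⊗[k] A →ₗ[k] Mult k ((Y ⊗[k] A) ⊗[k] (Y ⊗[k] A)) :=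
  if H : ∃ D, IsSmashComul ΔY ΔA ρ D then H.choose else 0

/-- The space `(ι ⊗ ε)Δ(C)`, spanned by the elements `c₍₁₎ ε(c₍₂₎ b) = (ι ⊗ ε)(Δ(c)(1 ⊗ b))` with
`c, b ∈ C` and `ε(b) = 1`. -/
def counitalPart {C : Type*} [NonUnitalRing C] [Module k C] [SMulCommClass k C C]
    [IsScalarTower k C C] (Δ : C →ₗ[k] Mult k (C ⊗[k] C)) (ε : C →ₗ[k] k) : Submodule k C :=
  Submodule.span k {x | ∃ c b : C, ε b = 1 ∧ x = counitRight ε (T₁ Δ (c ⊗ₜ b))}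

/-- The underlying space of the partial smash coproduct,
`(ι_Y ⊗ ι_A ⊗ ε̄) Δ̄ (Y ⋊ A) ⊆ Y ⊗ A`, where `ε̄ = ε_Y ⊗ ε_A`. -/
def partialSmash (ΔY : Y →ₗ[k] Mult k (Y ⊗[k] Y)) (ΔA : A →ₗ[k] Mult k (A ⊗[k] A))
    (ρ : Y →ₗ[k] Mult k (A ⊗[k] Y)) : Submodule k (Y ⊗[k] A) :=
  counitalPart (smashComul ΔY ΔA ρ) (tensorCounit (counit ΔY) (counit ΔA))

/-- The map `ρ : Y → M(A ⊗ Y)`, `ρ(y) = h ⊗ y`. -/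
def constCoaction (Y : Type*) [NonUnitalRing Y] [Module k Y] [SMulCommClass k Y Y]
    [IsScalarTower k Y Y] (h : Mult k A) : Y →ₗ[k] Mult k (A ⊗[k] Y) :=
  tmul (k := k) (R := A) (S := Y) h ∘ₗ incl

end Bialgebras

end MultHopf

end

open scoped TensorProduct

set_option linter.unusedSectionVars false

namespace MultHopf

open Mult

/-! Applying `ε ⊗ ι` to `h ⊗ h = (1 ⊗ h)Δ(h)` and using `ε(h) = 1` gives `h = h²`. Since `A` is
commutative, `h` is moreover central, so `hA` is a direct factor of `A` with projection `a ↦ ha`.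
Multiplying the hypotheses on `h` by `Δ(a)` gives `(h ⊗ h)Δ(a) = Δ(ha)(h ⊗ 1) = Δ(ha)(1 ⊗ h)`. Hence
`(h ⊗ h)Δ(a)(1 ⊗ b) = Δ(ha)(1 ⊗ hb)`, so `T₁`, and likewise `T₂`, commutes with the projection `h ⊗
h`. Both therefore restrict to bijections of `hA ⊗ hA`, and coassociativity, nondegeneracy and the
counit equations are inherited as well. This is statement 1; it is carried by `IsCorner.map_T₁`,
`IsCorner.map_T₂` and `IsCorner.isMultiplierHopf`.

For `ρ(y) = h ⊗ y` one has `T(y ⊗ a) = ha ⊗ y`, so the smash comultiplication is that of the tensor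
product, multiplied from the left by `1 ⊗ h ⊗ 1 ⊗ 1` (`isSmashComul_twistedComul`). Therefore `(ι ⊗
ε̄)(Δ̄(c)(1 ⊗ b)) = ε̄(b)(1 ⊗ h)c`, and the partial smash coproduct is exactly `Y ⊗ hA` inside `Y ⊗
A` (`counitalPart_twistedComul`). There the extra factor `h` acts as the identity, so `Δ̄` restricts
to the tensor product comultiplication (`twistedComul_tensorInclusion`). That `Y ⊗ hA` is a
counitary multiplier bialgebra is a general fact about tensor products
(`IsMultiplierBialgebra.tensor`, `IsHopfCounit.tensor`). The isomorphism is the inverse of the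
inclusion of `Y ⊗ hA`, corestricted to its image.

Two devices run through the proof. Coassociativity is rewritten as the identity `(T₂ ⊗ ι)(ι ⊗ T₁) =
(ι ⊗ T₁)(T₂ ⊗ ι)` between elements. Objects defined by choice (corestrictions, extensions, counits,
restrictions, the smash comultiplication) are pinned down by existence, together with uniqueness
where they must be identified. -/

theorem smulCommClass_tensor {k R S : Type*} [Field k] [NonUnitalRing R] [Module k R]
    [SMulCommClass k R R] [IsScalarTower k R R] [NonUnitalRing S] [Module k S]
    [SMulCommClass k S S] [IsScalarTower k S S] :
    SMulCommClass k (R ⊗[k] S) (R ⊗[k] S) := inferInstance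

theorem isScalarTower_tensor {k R S : Type*} [Field k] [NonUnitalRing R] [Module k R]
    [SMulCommClass k R R] [IsScalarTower k R R] [NonUnitalRing S] [Module k S]
    [SMulCommClass k S S] [IsScalarTower k S S] :
    IsScalarTower k (R ⊗[k] S) (R ⊗[k] S) := inferInstance

attribute [local instance] smulCommClass_tensor isScalarTower_tensor

/-! ### Nondegenerate algebras and their multipliers. -/

section Nondegenerate

variable {k : Type*} [Field k]
variable {R : Type*} [NonUnitalRing R] [Module k R] [SMulCommClass k R R] [IsScalarTower k R R]
variable {S : Type*} [NonUnitalRing S] [Module k S] [SMulCommClass k S S] [IsScalarTower k S S]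

@[simp] theorem Mult.incl_left (a b : R) : (incl (k := k) a).left b = a * b := rfl

@[simp] theorem Mult.incl_right (a b : R) : (incl (k := k) a).right b = b * a := rfl

@[simp] theorem Mult.tmul_left (m : Mult k R) (n : Mult k S) (x : R ⊗[k] S) :
    (tmul m n).left x = TensorProduct.map m.left n.left x := rfl

@[simp] theorem Mult.tmul_right (m : Mult k R) (n : Mult k S) (x : R ⊗[k] S) :
    (tmul m n).right x = TensorProduct.map m.right n.right x := rfl

@[simp] theorem counitLeft_tmul (φ : R →ₗ[k] k) (a : R) (b : S) :
    counitLeft φ (a ⊗ₜ[k] b) = φ a • b := rfl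

@[simp] theorem counitRight_tmul (φ : S →ₗ[k] k) (a : R) (b : S) :
    counitRight φ (a ⊗ₜ[k] b) = φ b • a := rfl

theorem counitLeft_map {R' S' : Type*} [NonUnitalRing R'] [Module k R'] [SMulCommClass k R' R']
    [IsScalarTower k R' R'] [NonUnitalRing S'] [Module k S'] [SMulCommClass k S' S']
    [IsScalarTower k S' S'] (φ : R' →ₗ[k] k) (f : R →ₗ[k] R') (g : S →ₗ[k] S') (x : R ⊗[k] S) :
    counitLeft φ (TensorProduct.map f g x) = g (counitLeft (φ ∘ₗ f) x) := by
  induction x using TensorProduct.induction_on with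
  | zero => simp
  | add x y hx hy => simp [hx, hy]
  | tmul a b => simp

theorem counitRight_map {R' S' : Type*} [NonUnitalRing R'] [Module k R'] [SMulCommClass k R' R']
    [IsScalarTower k R' R'] [NonUnitalRing S'] [Module k S'] [SMulCommClass k S' S']
    [IsScalarTower k S' S'] (φ : S' →ₗ[k] k) (f : R →ₗ[k] R') (g : S →ₗ[k] S') (x : R ⊗[k] S) :
    counitRight φ (TensorProduct.map f g x) = f (counitRight (φ ∘ₗ g) x) := by
  induction x using TensorProduct.induction_on with
  | zero => simp
  | add x y hx hy => simp [hx, hy]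
  | tmul a b => simp

/-- The coordinate functionals of a basis of `R` already separate the points of `R ⊗ S`. Arguments
about tensors can thus be carried out on slices. -/
theorem eq_zero_of_counitLeft {x : R ⊗[k] S} (H : ∀ φ : R →ₗ[k] k, counitLeft φ x = 0) :
    x = 0 := by
  let b := Module.Free.chooseBasis k R
  apply (TensorProduct.equivFinsuppOfBasisLeft (N := S) b).injective
  ext j
  rw [TensorProduct.equivFinsuppOfBasisLeft_apply, map_zero, Finsupp.zero_apply]
  exact H (b.coord j)

theorem eq_zero_of_counitRight {x : R ⊗[k] S} (H : ∀ φ : S →ₗ[k] k, counitRight φ x = 0) :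
    x = 0 := by
  let b := Module.Free.chooseBasis k S
  apply (TensorProduct.equivFinsuppOfBasisRight (M := R) b).injective
  ext j
  rw [TensorProduct.equivFinsuppOfBasisRight_apply, map_zero, Finsupp.zero_apply]
  exact H (b.coord j)

theorem tensor_mul_eq_map_mulRight (x : R ⊗[k] S) (a : R) (b : S) :
    x * a ⊗ₜ b = TensorProduct.map (LinearMap.mulRight k a) (LinearMap.mulRight k b) x := by
  induction x using TensorProduct.induction_on with
  | zero => simp
  | add x y hx hy => simp [hx, hy, add_mul]
  | tmul c d => simp

theorem tensor_mul_eq_map_mulLeft (x : R ⊗[k] S) (a : R) (b : S) :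
    a ⊗ₜ b * x = TensorProduct.map (LinearMap.mulLeft k a) (LinearMap.mulLeft k b) x := by
  induction x using TensorProduct.induction_on with
  | zero => simp
  | add x y hx hy => simp [hx, hy, mul_add]
  | tmul c d => simp

/-- The tensor product of nondegenerate algebras is nondegenerate; it is enough to test
on elementary tensors. -/
theorem eq_zero_of_mul_tmul (hR : IsNondegenerateAlg R) (hS : IsNondegenerateAlg S)
    {x : R ⊗[k] S} (H : ∀ a b, x * a ⊗ₜ b = 0) : x = 0 := by
  -- The legs are treated one at a time: slicing the first leg and using `S` gives `x(a ⊗ 1) = 0`,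
  -- then slicing the second leg and using `R` gives `x = 0`.
  refine eq_zero_of_counitRight fun φ => hR.1 _ fun a => ?_
  have key : TensorProduct.map (LinearMap.mulRight k a) LinearMap.id x = (0 : R ⊗[k] S) := by
    refine eq_zero_of_counitLeft fun ψ => hS.1 _ fun b => ?_
    have := congrArg (counitLeft ψ) (H a b)
    rw [tensor_mul_eq_map_mulRight, counitLeft_map] at this
    rw [counitLeft_map]
    simpa using this
  have := congrArg (counitRight φ) key
  rw [counitRight_map] at this
  simpa using this

theorem eq_zero_of_tmul_mul (hR : IsNondegenerateAlg R) (hS : IsNondegenerateAlg S)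
    {x : R ⊗[k] S} (H : ∀ a b, a ⊗ₜ b * x = 0) : x = 0 := by
  refine eq_zero_of_counitRight fun φ => hR.2 _ fun a => ?_
  have key : TensorProduct.map (LinearMap.mulLeft k a) LinearMap.id x = (0 : R ⊗[k] S) := by
    refine eq_zero_of_counitLeft fun ψ => hS.2 _ fun b => ?_
    have := congrArg (counitLeft ψ) (H a b)
    rw [tensor_mul_eq_map_mulLeft, counitLeft_map] at this
    rw [counitLeft_map]
    simpa using this
  have := congrArg (counitRight φ) key
  rw [counitRight_map] at this
  simpa using this

theorem IsNondegenerateAlg.tensor (hR : IsNondegenerateAlg R) (hS : IsNondegenerateAlg S) :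
    IsNondegenerateAlg (R ⊗[k] S) :=
  ⟨fun _ H => eq_zero_of_mul_tmul hR hS fun _ _ => H _,
    fun _ H => eq_zero_of_tmul_mul hR hS fun _ _ => H _⟩

theorem IsNondegenerateAlg.eq_of_mul (hR : IsNondegenerateAlg R) {x y : R}
    (H : ∀ a, x * a = y * a) : x = y := by
  rw [← sub_eq_zero]
  exact hR.1 _ fun _ => by rw [sub_mul, H, sub_self]

theorem IsNondegenerateAlg.eq_of_mul' (hR : IsNondegenerateAlg R) {x y : R}
    (H : ∀ a, a * x = a * y) : x = y := by
  rw [← sub_eq_zero]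
  exact hR.2 _ fun _ => by rw [mul_sub, H, sub_self]

/-- Linearity over `R` is automatic: after multiplication by `c` from the left, both sides become
`(cm)ab`. -/
theorem Mult.left_mul_apply (hR : IsNondegenerateAlg R) (m : Mult k R) (a b : R) :
    m.left (a * b) = m.left a * b :=
  hR.eq_of_mul' fun c => by rw [m.central, ← mul_assoc, ← mul_assoc, m.central]

theorem Mult.right_mul_apply (hR : IsNondegenerateAlg R) (m : Mult k R) (a b : R) :
    m.right (a * b) = a * m.right b :=
  hR.eq_of_mul fun c => by rw [← m.central, mul_assoc, mul_assoc, ← m.central]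

theorem Mult.ext_left (hR : IsNondegenerateAlg R) {m n : Mult k R}
    (H : ∀ a, m.left a = n.left a) : m = n :=
  ext' H fun a => hR.eq_of_mul fun b => by rw [← m.central, ← n.central, H]

theorem Mult.ext_right (hR : IsNondegenerateAlg R) {m n : Mult k R}
    (H : ∀ a, m.right a = n.right a) : m = n :=
  ext' (fun a => hR.eq_of_mul' fun b => by rw [m.central, n.central, H]) H

theorem Mult.incl_injective (hR : IsNondegenerateAlg R) :
    Function.Injective (incl : R →ₗ[k] Mult k R) := fun _ _ H =>
  hR.eq_of_mul fun c => congrArg (fun m => Mult.left m c) H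

/-- The values on elementary tensors lie in the range of the injective map `incl`, hence so do all
values, and composing with the inverse on the range shows that `corestrict` does not take its
default value. -/
theorem Mult.incl_corestrict (hR : IsNondegenerateAlg R) {V W : Type*} [AddCommGroup V]
    [Module k V] [AddCommGroup W] [Module k W] (f : V ⊗[k] W →ₗ[k] Mult k R)
    (H : ∀ v w, ∃ x, incl x = f (v ⊗ₜ w)) (z : V ⊗[k] W) : incl (corestrict f z) = f z := by
  have hf : ∀ z, f z ∈ LinearMap.range (incl : R →ₗ[k] Mult k R) := by
    intro z
    induction z using TensorProduct.induction_on with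
    | zero => simp
    | add x y hx hy => rw [map_add]; exact add_mem hx hy
    | tmul v w => exact H v w
  have ex : ∃ g : V ⊗[k] W →ₗ[k] R, ∀ v, incl (g v) = f v := by
    refine ⟨(LinearEquiv.ofInjective _ (incl_injective hR)).symm.toLinearMap ∘ₗ
      f.codRestrict _ hf, fun v => ?_⟩
    have := LinearEquiv.apply_symm_apply (LinearEquiv.ofInjective _ (incl_injective (k := k) hR))
      (f.codRestrict _ hf v)
    exact congrArg Subtype.val this
  unfold corestrict
  rw [dif_pos ex]
  exact ex.choose_spec z

/-- In a commutative nondegenerate algebra all multipliers commute. -/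
theorem Mult.left_left_comm (hR : IsNondegenerateAlg R) (hc : ∀ a b : R, a * b = b * a)
    (m n : Mult k R) (a : R) : m.left (n.left a) = n.left (m.left a) :=
  hR.eq_of_mul fun b => by
    calc m.left (n.left a) * b = m.left (b * n.left a) := by rw [← left_mul_apply hR, hc]
      _ = m.left b * n.left a := left_mul_apply hR _ _ _
      _ = n.left (a * m.left b) := by rw [hc, ← left_mul_apply hR]
      _ = n.left (m.left a * b) := by rw [hc a, ← left_mul_apply hR, hc b, left_mul_apply hR]
      _ = n.left (m.left a) * b := left_mul_apply hR _ _ _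

theorem Mult.right_eq_left (hR : IsNondegenerateAlg R) (hc : ∀ a b : R, a * b = b * a)
    (m : Mult k R) (a : R) : m.right a = m.left a :=
  hR.eq_of_mul fun b => by
    rw [← m.central, hc, ← left_mul_apply hR, ← left_mul_apply hR, hc]

theorem tensor_mul_comm (hR : ∀ a b : R, a * b = b * a) (hS : ∀ a b : S, a * b = b * a)
    (x y : R ⊗[k] S) : x * y = y * x := by
  induction x using TensorProduct.induction_on with
  | zero => simp
  | add x x' hx hx' => rw [add_mul, mul_add, hx, hx']
  | tmul a b =>
    induction y using TensorProduct.induction_on with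
    | zero => simp
    | add y y' hy hy' => rw [add_mul, mul_add, hy, hy']
    | tmul c d => rw [Algebra.TensorProduct.tmul_mul_tmul, Algebra.TensorProduct.tmul_mul_tmul,
        hR, hS]

end Nondegenerate

/-! ### Covered comultiplications, and coassociativity as an identity of elements. -/

section Covers

variable {k : Type*} [Field k]
variable {A : Type*} [NonUnitalRing A] [Module k A] [SMulCommClass k A A] [IsScalarTower k A A]

/-- The four spaces `Δ(A)(1 ⊗ A)`, `(A ⊗ 1)Δ(A)`, `Δ(A)(A ⊗ 1)`, `(1 ⊗ A)Δ(A)` are contained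
in `A ⊗ A`, for a linear map `Δ` on a nondegenerate algebra. -/
structure IsCovered (Δ : A →ₗ[k] Mult k (A ⊗[k] A)) : Prop where
  nondegenerate : IsNondegenerateAlg A
  cover₁ : ∀ a b, ∃ x : A ⊗[k] A, incl x = Δ a * snd A b
  cover₂ : ∀ a b, ∃ x : A ⊗[k] A, incl x = fst A a * Δ b
  cover₃ : ∀ a b, ∃ x : A ⊗[k] A, incl x = Δ a * fst A b
  cover₄ : ∀ a b, ∃ x : A ⊗[k] A, incl x = snd A a * Δ b

theorem IsMultiplierBialgebra.covered {Δ : A →ₗ[k] Mult k (A ⊗[k] A)}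
    (H : IsMultiplierBialgebra Δ) : IsCovered Δ :=
  ⟨H.nondegenerate, H.cover₁, H.cover₂, H.cover₃, H.cover₄⟩

namespace IsCovered

variable {Δ : A →ₗ[k] Mult k (A ⊗[k] A)}

theorem incl_T₁ (H : IsCovered Δ) (a b : A) : incl (T₁ Δ (a ⊗ₜ b)) = Δ a * snd A b :=
  incl_corestrict (H.nondegenerate.tensor H.nondegenerate) _ H.cover₁ _

theorem incl_T₂ (H : IsCovered Δ) (a b : A) : incl (T₂ Δ (a ⊗ₜ b)) = fst A a * Δ b :=
  incl_corestrict (H.nondegenerate.tensor H.nondegenerate) _ H.cover₂ _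

theorem incl_T₃ (H : IsCovered Δ) (a b : A) : incl (T₃ Δ (a ⊗ₜ b)) = Δ a * fst A b :=
  incl_corestrict (H.nondegenerate.tensor H.nondegenerate) _ H.cover₃ _

theorem incl_T₄ (H : IsCovered Δ) (a b : A) : incl (T₄ Δ (a ⊗ₜ b)) = snd A a * Δ b :=
  incl_corestrict (H.nondegenerate.tensor H.nondegenerate) _ H.cover₄ _

theorem T₁_mul (H : IsCovered Δ) (a b : A) (x : A ⊗[k] A) :
    T₁ Δ (a ⊗ₜ b) * x = (Δ a).left (TensorProduct.map LinearMap.id (LinearMap.mulLeft k b) x) :=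
  congrArg (fun m => Mult.left m x) (H.incl_T₁ a b)

theorem mul_T₂ (H : IsCovered Δ) (a b : A) (x : A ⊗[k] A) :
    x * T₂ Δ (a ⊗ₜ b) = (Δ b).right (TensorProduct.map (LinearMap.mulRight k a) LinearMap.id x) :=
  congrArg (fun m => Mult.right m x) (H.incl_T₂ a b)

theorem T₃_mul (H : IsCovered Δ) (a b : A) (x : A ⊗[k] A) :
    T₃ Δ (a ⊗ₜ b) * x = (Δ a).left (TensorProduct.map (LinearMap.mulLeft k b) LinearMap.id x) :=
  congrArg (fun m => Mult.left m x) (H.incl_T₃ a b)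

theorem mul_T₄ (H : IsCovered Δ) (a b : A) (x : A ⊗[k] A) :
    x * T₄ Δ (a ⊗ₜ b) = (Δ b).right (TensorProduct.map LinearMap.id (LinearMap.mulRight k a) x) :=
  congrArg (fun m => Mult.right m x) (H.incl_T₄ a b)

end IsCovered

/-- Coassociativity in terms of `T₁` and `T₂`: `(T₂ ⊗ ι)(ι ⊗ T₁) = (ι ⊗ T₁)(T₂ ⊗ ι)`. -/
def IsCoassociative (Δ : A →ₗ[k] Mult k (A ⊗[k] A)) : Prop :=
  ∀ a b c : A,
    TensorProduct.assoc k A A A (TensorProduct.map (T₂ Δ) LinearMap.id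
      ((TensorProduct.assoc k A A A).symm (a ⊗ₜ T₁ Δ (b ⊗ₜ c)))) =
    TensorProduct.map LinearMap.id (T₁ Δ) (TensorProduct.assoc k A A A (T₂ Δ (a ⊗ₜ b) ⊗ₜ c))

section

variable {R : Type*} [NonUnitalRing R] [Module k R] [SMulCommClass k R R] [IsScalarTower k R R]
variable {S : Type*} [NonUnitalRing S] [Module k S] [SMulCommClass k S S] [IsScalarTower k S S]

theorem Mult.tmul_mul_tmul (m m' : Mult k R) (n n' : Mult k S) :
    tmul m n * tmul m' n' = tmul (m * m') (n * n') :=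
  ext' (fun x => by
      simp only [left_mul, tmul_left]
      exact (LinearMap.congr_fun (TensorProduct.map_comp m.left n.left m'.left n'.left) x).symm)
    (fun x => by
      simp only [right_mul, tmul_right]
      exact (LinearMap.congr_fun
        (TensorProduct.map_comp m'.right n'.right m.right n.right) x).symm)

theorem Mult.incl_tmul (a : R) (b : S) :
    incl (a ⊗ₜ[k] b) = tmul (incl (k := k) a) (incl (k := k) b) :=
  ext' (tensor_mul_eq_map_mulLeft · a b) (tensor_mul_eq_map_mulRight · a b)

theorem Mult.congr_incl (e : R ≃ₗ[k] S) (he : ∀ x y, e (x * y) = e x * e y) (a : R) :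
    Mult.congr e he (incl a) = incl (e a) :=
  ext' (fun x => (he a (e.symm x)).trans (by simp)) (fun x => (he (e.symm x) a).trans (by simp))

end

theorem IsCovered.comulId_eq {Δ : A →ₗ[k] Mult k (A ⊗[k] A)} (H : IsCovered Δ) (a : A)
    (x : A ⊗[k] A) :
    tmul (fst A a) 1 * comulId Δ x =
      incl (TensorProduct.map (T₂ Δ) LinearMap.id ((TensorProduct.assoc k A A A).symm
        (a ⊗ₜ x))) := by
  induction x using TensorProduct.induction_on with
  | zero => simp
  | add x y hx hy => simp only [map_add, mul_add, hx, hy, TensorProduct.tmul_add]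
  | tmul p q =>
    rw [TensorProduct.assoc_symm_tmul, TensorProduct.map_tmul, incl_tmul, H.incl_T₂]
    exact (tmul_mul_tmul _ _ _ _).trans (by rw [one_mul]; rfl)

theorem IsCovered.idComul_eq {Δ : A →ₗ[k] Mult k (A ⊗[k] A)} (H : IsCovered Δ) (c : A)
    (x : A ⊗[k] A) :
    idComul Δ x * tmul 1 (snd A c) =
      incl (TensorProduct.map LinearMap.id (T₁ Δ) (TensorProduct.assoc k A A A (x ⊗ₜ c))) := by
  induction x using TensorProduct.induction_on with
  | zero => simp
  | add x y hx hy => simp only [map_add, add_mul, hx, hy, TensorProduct.add_tmul]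
  | tmul p q =>
    rw [TensorProduct.assoc_tmul, TensorProduct.map_tmul, incl_tmul, H.incl_T₁]
    exact (tmul_mul_tmul _ _ _ _).trans (by rw [mul_one]; rfl)

/-- Once covered by `a` on the left and `c` on the right, both sides of the coassociativity axiom
are elements of the triple tensor product, which embeds in its multiplier algebra by nondegeneracy.
-/
theorem IsCovered.isCoassociative_iff {Δ : A →ₗ[k] Mult k (A ⊗[k] A)} (H : IsCovered Δ) :
    IsCoassociative Δ ↔ ∀ a b c : A,
      Mult.congr (TensorProduct.assoc k A A A) assoc_mul
          (tmul (fst A a) 1 * comulId Δ (T₁ Δ (b ⊗ₜ c))) =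
        idComul Δ (T₂ Δ (a ⊗ₜ b)) * tmul 1 (snd A c) := by
  have hn := H.nondegenerate
  simp only [H.comulId_eq, H.idComul_eq, congr_incl]
  exact forall₃_congr fun a b c => (incl_injective
    (hn.tensor (k := k) (hn.tensor (k := k) hn))).eq_iff.symm

end Covers

/-! ### Multiplication of one leg of a tensor. -/

section Legs

variable {k : Type*} [Field k]
variable {A : Type*} [NonUnitalRing A] [Module k A] [SMulCommClass k A A] [IsScalarTower k A A]
variable {B : Type*} [NonUnitalRing B] [Module k B] [SMulCommClass k B B] [IsScalarTower k B B]

theorem fst_mul_incl (c : A) (x : A ⊗[k] B) :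
    fst B c * incl x = incl (TensorProduct.map (LinearMap.mulLeft k c) LinearMap.id x) := by
  induction x using TensorProduct.induction_on with
  | zero => simp
  | add x y hx hy => simp only [map_add, mul_add, hx, hy]
  | tmul a b =>
    rw [TensorProduct.map_tmul, incl_tmul, incl_tmul]
    exact (tmul_mul_tmul _ _ _ _).trans (by
      rw [one_mul]; congr 2; exact ext' (fun d => mul_assoc c a d |>.symm) fun d => mul_assoc d c a)

theorem snd_mul_incl (c : B) (x : A ⊗[k] B) :
    snd A c * incl x = incl (TensorProduct.map LinearMap.id (LinearMap.mulLeft k c) x) := by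
  induction x using TensorProduct.induction_on with
  | zero => simp
  | add x y hx hy => simp only [map_add, mul_add, hx, hy]
  | tmul a b =>
    rw [TensorProduct.map_tmul, incl_tmul, incl_tmul]
    exact (tmul_mul_tmul _ _ _ _).trans (by
      rw [one_mul]; congr 1; exact ext' (fun d => mul_assoc c b d |>.symm) fun d => mul_assoc d c b)

theorem incl_mul_fst (c : A) (x : A ⊗[k] B) :
    incl x * fst B c = incl (TensorProduct.map (LinearMap.mulRight k c) LinearMap.id x) := by
  induction x using TensorProduct.induction_on with
  | zero => simp
  | add x y hx hy => simp only [map_add, add_mul, hx, hy]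
  | tmul a b =>
    rw [TensorProduct.map_tmul, incl_tmul, incl_tmul]
    exact (tmul_mul_tmul _ _ _ _).trans (by
      rw [mul_one]; congr 2; exact ext' (fun d => mul_assoc a c d |>.symm) fun d => mul_assoc d a c)

theorem incl_mul_snd (c : B) (x : A ⊗[k] B) :
    incl x * snd A c = incl (TensorProduct.map LinearMap.id (LinearMap.mulRight k c) x) := by
  induction x using TensorProduct.induction_on with
  | zero => simp
  | add x y hx hy => simp only [map_add, add_mul, hx, hy]
  | tmul a b =>
    rw [TensorProduct.map_tmul, incl_tmul, incl_tmul]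
    exact (tmul_mul_tmul _ _ _ _).trans (by
      rw [mul_one]; congr 1; exact ext' (fun d => mul_assoc b c d |>.symm) fun d => mul_assoc d b c)

end Legs

/-! ### Existence, uniqueness and multiplicativity of the counit. -/

section Counit

variable {k : Type*} [Field k]
variable {A : Type*} [NonUnitalRing A] [Module k A] [SMulCommClass k A A] [IsScalarTower k A A]
variable {Δ : A →ₗ[k] Mult k (A ⊗[k] A)}

theorem IsMultiplierBialgebra.isCoassociative (H : IsMultiplierBialgebra Δ) :
    IsCoassociative Δ := H.covered.isCoassociative_iff.2 H.coassoc

namespace IsCovered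

theorem incl_inj (H : IsCovered Δ) {x y : A ⊗[k] A} :
    (incl (k := k) x = incl y) ↔ x = y :=
  (incl_injective (H.nondegenerate.tensor (k := k) H.nondegenerate)).eq_iff

/-- `(c ⊗ 1)(Δ(a)(1 ⊗ b)) = ((c ⊗ 1)Δ(a))(1 ⊗ b)`. -/
theorem map_mulLeft_T₁ (H : IsCovered Δ) (a b c : A) :
    TensorProduct.map (LinearMap.mulLeft k c) LinearMap.id (T₁ Δ (a ⊗ₜ b)) =
      TensorProduct.map LinearMap.id (LinearMap.mulRight k b) (T₂ Δ (c ⊗ₜ a)) := by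
  rw [← H.incl_inj, ← fst_mul_incl, ← incl_mul_snd, H.incl_T₁, H.incl_T₂, mul_assoc]

/-- `(1 ⊗ c)(Δ(a)(1 ⊗ b)) = ((1 ⊗ c)Δ(a))(1 ⊗ b)`. -/
theorem map_mulLeft_T₁' (H : IsCovered Δ) (a b c : A) :
    TensorProduct.map LinearMap.id (LinearMap.mulLeft k c) (T₁ Δ (a ⊗ₜ b)) =
      TensorProduct.map LinearMap.id (LinearMap.mulRight k b) (T₄ Δ (c ⊗ₜ a)) := by
  rw [← H.incl_inj, ← snd_mul_incl, ← incl_mul_snd, H.incl_T₁, H.incl_T₄, mul_assoc]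

/-- `(c ⊗ 1)(Δ(a)(b ⊗ 1)) = ((c ⊗ 1)Δ(a))(b ⊗ 1)`. -/
theorem map_mulLeft_T₃ (H : IsCovered Δ) (a b c : A) :
    TensorProduct.map (LinearMap.mulLeft k c) LinearMap.id (T₃ Δ (a ⊗ₜ b)) =
      TensorProduct.map (LinearMap.mulRight k b) LinearMap.id (T₂ Δ (c ⊗ₜ a)) := by
  rw [← H.incl_inj, ← fst_mul_incl, ← incl_mul_fst, H.incl_T₃, H.incl_T₂, mul_assoc]

end IsCovered

theorem map_mul'_assoc (x : A ⊗[k] A) (b : A) :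
    TensorProduct.map LinearMap.id (LinearMap.mul' k A) (TensorProduct.assoc k A A A (x ⊗ₜ b)) =
      TensorProduct.map LinearMap.id (LinearMap.mulRight k b) x := by
  induction x using TensorProduct.induction_on with
  | zero => simp
  | add x y hx hy => simp only [map_add, TensorProduct.add_tmul, hx, hy]
  | tmul a c => simp

/-- The inverses of `T₁` and `T₂`, composed with the multiplication, satisfy
`p ⊗ m(T₁⁻¹(q ⊗ b)) = m(T₂⁻¹(p ⊗ q)) ⊗ b`. -/
theorem IsMultiplierHopf.tmul_mul'_symm (H : IsMultiplierHopf Δ) (p q b : A) :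
    p ⊗ₜ[k] LinearMap.mul' k A
        ((LinearEquiv.ofBijective (T₁ Δ) H.bijective_T₁).symm (q ⊗ₜ b)) =
      LinearMap.mul' k A ((LinearEquiv.ofBijective (T₂ Δ) H.bijective_T₂).symm (p ⊗ₜ q)) ⊗ₜ b := by
  set e₁ := LinearEquiv.ofBijective (T₁ Δ) H.bijective_T₁
  set e₂ := LinearEquiv.ofBijective (T₂ Δ) H.bijective_T₂
  have he₁ : ∀ x, e₁.symm (T₁ Δ x) = x := fun x => e₁.symm_apply_apply x
  let F : A ⊗[k] (A ⊗[k] A) →ₗ[k] A ⊗[k] A :=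
    TensorProduct.map LinearMap.id (LinearMap.mul' k A ∘ₗ e₁.symm.toLinearMap)
  have hF : ∀ y : A ⊗[k] (A ⊗[k] A), F (TensorProduct.map LinearMap.id (T₁ Δ) y) =
      TensorProduct.map LinearMap.id (LinearMap.mul' k A) y := fun y => by
    rw [← LinearMap.comp_apply, ← TensorProduct.map_comp]
    congr 2
    exact LinearMap.ext fun x => congrArg (LinearMap.mul' k A) (he₁ x)
  -- Here `F = ι ⊗ m T₁⁻¹` is applied to coassociativity: `T₁⁻¹` cancels `T₁`, and what remains is
  -- `T₂(c ⊗ a)(1 ⊗ b) = (c ⊗ 1)T₁(a ⊗ b)`.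
  have step : ∀ (c : A) (x : A ⊗[k] A),
      F (TensorProduct.assoc k A A A (TensorProduct.map (T₂ Δ) LinearMap.id
        ((TensorProduct.assoc k A A A).symm (c ⊗ₜ T₁ Δ x)))) =
      TensorProduct.map (LinearMap.mulLeft k c) LinearMap.id (T₁ Δ x) := by
    intro c x
    induction x using TensorProduct.induction_on with
    | zero => simp
    | add x y hx hy => simp only [map_add, TensorProduct.tmul_add, hx, hy]
    | tmul a b =>
      rw [H.isCoassociative, hF, map_mul'_assoc, H.covered.map_mulLeft_T₁]
  -- By surjectivity of `T₁` the element `T₁(x)` in the previous identity may be any `a ⊗ b`; it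
  -- then reads `F(T₂(c ⊗ a) ⊗ b) = ca ⊗ b`.
  have step' : ∀ x : A ⊗[k] A, F (TensorProduct.assoc k A A A (T₂ Δ x ⊗ₜ b)) =
      LinearMap.mul' k A x ⊗ₜ b := by
    intro x
    induction x using TensorProduct.induction_on with
    | zero => simp
    | add x y hx hy => simp only [map_add, TensorProduct.add_tmul, hx, hy]
    | tmul c a =>
      have := step c (e₁.symm (a ⊗ₜ b))
      rw [show T₁ Δ (e₁.symm (a ⊗ₜ b)) = a ⊗ₜ b from e₁.apply_symm_apply _] at this
      simpa using this
  have := step' (e₂.symm (p ⊗ₜ q))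
  rwa [show T₂ Δ (e₂.symm (p ⊗ₜ q)) = p ⊗ₜ q from e₂.apply_symm_apply _] at this

/-- In `p ⊗ m(T₁⁻¹(q ⊗ b)) = m(T₂⁻¹(p ⊗ q)) ⊗ b` the left side does not see `b` in the first leg and
the right side carries `b` untouched in the second. A functional `φ` with `φ(p) = 1` therefore turns
it into `m(T₁⁻¹(q ⊗ b)) = ε(q)b` with `ε(q) = φ(m(T₂⁻¹(p ⊗ q)))`. The same `ε` serves for `T₂⁻¹`, by
the identity with `p` in the place of `b`. -/
theorem IsMultiplierHopf.exists_counit (H : IsMultiplierHopf Δ) : ∃ ε, IsHopfCounit Δ ε := by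
  set e₁ := LinearEquiv.ofBijective (T₁ Δ) H.bijective_T₁ with he₁
  set e₂ := LinearEquiv.ofBijective (T₂ Δ) H.bijective_T₂ with he₂
  by_cases triv : ∀ a : A, a = 0
  · exact ⟨0, fun a b => ⟨(triv _).trans (triv _).symm, (triv _).trans (triv _).symm⟩⟩
  push Not at triv
  obtain ⟨p, hp⟩ := triv
  obtain ⟨φ, hφ⟩ : ∃ φ : A →ₗ[k] k, φ p = 1 := by
    obtain ⟨φ, hφ⟩ := not_forall.1 (mt (Module.forall_dual_apply_eq_zero_iff k p).1 hp)
    exact ⟨(φ p)⁻¹ • φ, by simp [hφ]⟩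
  let ε : A →ₗ[k] k := φ ∘ₗ LinearMap.mul' k A ∘ₗ e₂.symm.toLinearMap ∘ₗ TensorProduct.mk k A A p
  have h₁ : ∀ q b, LinearMap.mul' k A (e₁.symm (q ⊗ₜ b)) = ε q • b := fun q b => by
    have := congrArg (counitLeft φ) (H.tmul_mul'_symm p q b)
    rw [← he₁, ← he₂, counitLeft_tmul, counitLeft_tmul, hφ, one_smul] at this
    exact this
  have h₂ : ∀ q c, LinearMap.mul' k A (e₂.symm (c ⊗ₜ q)) = ε q • c := fun q c => by
    have := congrArg (counitRight φ) (H.tmul_mul'_symm c q p)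
    rw [← he₁, ← he₂, h₁] at this
    simpa [hφ] using this.symm
  have h₁' : ∀ x, counitLeft ε x = LinearMap.mul' k A (e₁.symm x) := fun x => by
    induction x using TensorProduct.induction_on with
    | zero => simp
    | add x y hx hy => simp only [map_add, hx, hy]
    | tmul a c => rw [h₁, counitLeft_tmul]
  have h₂' : ∀ x, counitRight ε x = LinearMap.mul' k A (e₂.symm x) := fun x => by
    induction x using TensorProduct.induction_on with
    | zero => simp
    | add x y hx hy => simp only [map_add, hx, hy]
    | tmul a c => rw [h₂, counitRight_tmul]
  refine ⟨ε, fun a b => ⟨?_, ?_⟩⟩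
  · rw [h₁', show e₁.symm (T₁ Δ (a ⊗ₜ b)) = a ⊗ₜ b from e₁.symm_apply_apply _,
      LinearMap.mul'_apply]
  · rw [h₂', show e₂.symm (T₂ Δ (a ⊗ₜ b)) = a ⊗ₜ b from e₂.symm_apply_apply _,
      LinearMap.mul'_apply]

theorem IsMultiplierHopf.isHopfCounit_counit (H : IsMultiplierHopf Δ) :
    IsHopfCounit Δ (counit Δ) := by
  have := H.exists_counit
  rw [counit, dif_pos this]
  exact this.choose_spec

theorem IsHopfCounit.counitLeft_T₁ {ε : A →ₗ[k] k} (hε : IsHopfCounit Δ ε) (x : A ⊗[k] A) :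
    counitLeft ε (T₁ Δ x) = LinearMap.mul' k A x := by
  induction x using TensorProduct.induction_on with
  | zero => simp
  | add x y hx hy => simp only [map_add, hx, hy]
  | tmul a b => rw [(hε a b).1, LinearMap.mul'_apply]

theorem linearMap_eq_of_smul_eq {ε ε' : A →ₗ[k] k}
    (H : ∀ a b : A, ε a • b = ε' a • b) : ε = ε' := by
  ext a
  by_contra hne
  have : ∀ b : A, b = 0 := fun b => by
    have := H a b
    rw [← sub_eq_zero, ← sub_smul, smul_eq_zero, sub_eq_zero] at this
    exact this.resolve_left hne
  exact hne (by rw [this a, map_zero, map_zero])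

/-- For any counit, `(ε ⊗ ι)T₁` is the multiplication; as `T₁` is surjective, this determines `ε ⊗
ι`. -/
theorem IsMultiplierHopf.counit_unique (H : IsMultiplierHopf Δ) {ε : A →ₗ[k] k}
    (hε : IsHopfCounit Δ ε) : counit Δ = ε := by
  refine linearMap_eq_of_smul_eq fun a b => ?_
  obtain ⟨x, hx⟩ := H.bijective_T₁.2 (a ⊗ₜ b)
  rw [← counitLeft_tmul, ← counitLeft_tmul, ← hx, hε.counitLeft_T₁,
    H.isHopfCounit_counit.counitLeft_T₁]

theorem IsMultiplierHopf.counit_mul (H : IsMultiplierHopf Δ) (a b : A) :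
    counit Δ (a * b) = counit Δ a * counit Δ b := by
  set ε := counit Δ
  have hε : IsHopfCounit Δ ε := H.isHopfCounit_counit
  have hn := H.nondegenerate
  have hn2 : IsNondegenerateAlg (A ⊗[k] A) := hn.tensor hn
  -- `(ε ⊗ ι)(Δ(a)x) = a (ε ⊗ ι)(x)`: by surjectivity take `x = T₁(b ⊗ c)`, and use `Δ(a)T₁(b ⊗ c) =
  -- T₁(ab ⊗ c)`.
  have h₁ : ∀ (a : A) (x : A ⊗[k] A), counitLeft ε ((Δ a).left x) = a * counitLeft ε x := by
    intro a x
    obtain ⟨y, rfl⟩ := H.bijective_T₁.2 x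
    induction y using TensorProduct.induction_on with
    | zero => simp
    | add x y hx hy => simp only [map_add, mul_add, hx, hy]
    | tmul b c =>
      have : (Δ a).left (T₁ Δ (b ⊗ₜ c)) = T₁ Δ ((a * b) ⊗ₜ c) :=
        hn2.eq_of_mul fun z => by
          rw [← left_mul_apply hn2, H.covered.T₁_mul, H.covered.T₁_mul, H.map_mul, left_mul]
      rw [this, (hε _ _).1, (hε _ _).1, mul_assoc]
  -- `(ε ⊗ ι)(x(b ⊗ 1)) = ε(b)(ε ⊗ ι)(x)`: for `x = T₁(a ⊗ c)` one has `x(b ⊗ 1) = Δ(a)(b ⊗ c)`, to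
  -- which the previous step applies. For `x = a ⊗ c` this is multiplicativity of `ε`.
  have h₂ : ∀ (b : A) (x : A ⊗[k] A),
      counitLeft ε (TensorProduct.map (LinearMap.mulRight k b) LinearMap.id x) =
        ε b • counitLeft ε x := by
    intro b x
    obtain ⟨y, rfl⟩ := H.bijective_T₁.2 x
    induction y using TensorProduct.induction_on with
    | zero => simp
    | add x y hx hy => simp only [map_add, smul_add, hx, hy]
    | tmul a c =>
      have : TensorProduct.map (LinearMap.mulRight k b) LinearMap.id (T₁ Δ (a ⊗ₜ c)) =
          (Δ a).left (b ⊗ₜ c) := by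
        rw [← H.covered.incl_inj, ← incl_mul_fst, H.covered.incl_T₁]
        refine ext_left hn2 fun z => ?_
        rw [incl_left, ← left_mul_apply hn2, left_mul, left_mul]
        congr 1
        induction z using TensorProduct.induction_on with
        | zero => simp
        | add x y hx hy => simp only [map_add, mul_add, hx, hy]
        | tmul d e => exact (Algebra.TensorProduct.tmul_mul_tmul (R := k) b d c e).symm
      rw [this, h₁, (hε _ _).1, counitLeft_tmul, mul_smul_comm]
  have h₃ : ε ∘ₗ LinearMap.mulRight k b = ε b • ε := linearMap_eq_of_smul_eq fun a c => by
    simpa [mul_smul] using h₂ b (a ⊗ₜ c)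
  exact (LinearMap.congr_fun h₃ a).trans (mul_comm _ _)

/-- For a counit in the sense of multiplier Hopf algebras, all four counit identities hold. -/
theorem IsHopfCounit.counitary (H : IsMultiplierBialgebra Δ) {ε : A →ₗ[k] k}
    (hε : IsHopfCounit Δ ε) (hmul : ∀ a b, ε (a * b) = ε a * ε b) :
    IsCounitaryMultiplierBialgebra Δ ε where
  toIsMultiplierBialgebra := H
  counit_mul := hmul
  -- The identity for `T₄` follows by applying `ε ⊗ ι` to `(1 ⊗ b)T₁(a ⊗ c) = T₄(b ⊗ a)(1 ⊗ c)` and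
  -- cancelling `c`. The one for `T₃` is obtained from `T₂` in the same way.
  left_counit a b := ⟨(hε a b).1, H.nondegenerate.eq_of_mul fun c => by
    have := congrArg (counitLeft ε) (H.covered.map_mulLeft_T₁' a c b)
    rw [counitLeft_map, counitLeft_map, LinearMap.comp_id, (hε a c).1] at this
    simpa [mul_assoc] using this.symm⟩
  right_counit a b := ⟨H.nondegenerate.eq_of_mul' fun c => by
    have := congrArg (counitRight ε) (H.covered.map_mulLeft_T₃ a b c)
    rw [counitRight_map, counitRight_map, LinearMap.comp_id, (hε c a).2] at this
    simpa [mul_assoc] using this, (hε b a).2⟩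

theorem IsMultiplierHopf.counitary (H : IsMultiplierHopf Δ) :
    IsCounitaryMultiplierBialgebra Δ (counit Δ) :=
  H.isHopfCounit_counit.counitary H.toIsMultiplierBialgebra H.counit_mul

end Counit

/-! ### Direct factors cut out by a central idempotent multiplier. -/

section Corner

variable {k : Type*} [Field k]
variable {A : Type*} [NonUnitalRing A] [Module k A] [SMulCommClass k A A] [IsScalarTower k A A]
variable {B : Type*} [NonUnitalRing B] [Module k B] [SMulCommClass k B B] [IsScalarTower k B B]
variable {A' : Type*} [NonUnitalRing A'] [Module k A'] [SMulCommClass k A' A']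
  [IsScalarTower k A' A']
variable {B' : Type*} [NonUnitalRing B'] [Module k B'] [SMulCommClass k B' B']
  [IsScalarTower k B' B']

/-- `i : B → A` identifies `B` with the direct factor `e A` of `A`, where `e` is a central
idempotent multiplier of `A`, and `p : A → B` is the multiplication by `e`. -/
structure IsCorner (i : B →ₗ[k] A) (p : A →ₗ[k] B) : Prop where
  proj_incl : ∀ b, p (i b) = b
  map_mul : ∀ b b', i (b * b') = i b * i b'
  mul_incl : ∀ a b, a * i b = i (p a * b)
  incl_mul : ∀ b a, i b * a = i (b * p a)

theorem isCorner_of_equiv (e : B ≃ₗ[k] A) (he : ∀ x y, e (x * y) = e x * e y) :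
    IsCorner e.toLinearMap e.symm.toLinearMap where
  proj_incl b := e.symm_apply_apply b
  map_mul := he
  mul_incl a b := by simp [he]
  incl_mul b a := by simp [he]

namespace IsCorner

variable {i : B →ₗ[k] A} {p : A →ₗ[k] B} {i' : B' →ₗ[k] A'} {p' : A' →ₗ[k] B'}

theorem injective (H : IsCorner i p) : Function.Injective i :=
  Function.LeftInverse.injective H.proj_incl

theorem map_mul_map (H : IsCorner i p) (H' : IsCorner i' p') (x y : B ⊗[k] B') :
    TensorProduct.map i i' (x * y) = TensorProduct.map i i' x * TensorProduct.map i i' y := by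
  induction x using TensorProduct.induction_on with
  | zero => simp
  | add x x' hx hx' => simp only [add_mul, map_add, hx, hx']
  | tmul a b =>
    induction y using TensorProduct.induction_on with
    | zero => simp
    | add y y' hy hy' => simp only [mul_add, map_add, hy, hy']
    | tmul c d => simp [H.map_mul, H'.map_mul]

theorem tensor (H : IsCorner i p) (H' : IsCorner i' p') :
    IsCorner (TensorProduct.map i i') (TensorProduct.map p p') where
  proj_incl x := by
    induction x using TensorProduct.induction_on with
    | zero => simp
    | add x y hx hy => simp only [map_add, hx, hy]
    | tmul a b => simp [H.proj_incl, H'.proj_incl]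
  map_mul := H.map_mul_map H'
  mul_incl x y := by
    induction x using TensorProduct.induction_on with
    | zero => simp
    | add x x' hx hx' => simp only [add_mul, map_add, hx, hx']
    | tmul a b =>
      induction y using TensorProduct.induction_on with
      | zero => simp
      | add y y' hy hy' => simp only [mul_add, map_add, hy, hy']
      | tmul c d => simp [H.mul_incl, H'.mul_incl]
  incl_mul x y := by
    induction x using TensorProduct.induction_on with
    | zero => simp
    | add x x' hx hx' => simp only [add_mul, map_add, hx, hx']
    | tmul a b =>
      induction y using TensorProduct.induction_on with
      | zero => simp
      | add y y' hy hy' => simp only [mul_add, map_add, hy, hy']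
      | tmul c d => simp [H.incl_mul, H'.incl_mul]

theorem nondegenerate (H : IsCorner i p) (hA : IsNondegenerateAlg A) : IsNondegenerateAlg B :=
  ⟨fun b hb => H.injective (by
      rw [map_zero]
      exact hA.1 _ fun a => by rw [H.incl_mul, hb, map_zero]),
    fun b hb => H.injective (by
      rw [map_zero]
      exact hA.2 _ fun a => by rw [H.mul_incl, hb, map_zero])⟩

theorem incl_proj_mul_comm (H : IsCorner i p) (a b : A) : i (p a) * b = a * i (p b) := by
  rw [H.incl_mul, H.mul_incl]

theorem incl_proj_mul (H : IsCorner i p) (hA : IsNondegenerateAlg A) (a b : A) :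
    i (p (a * b)) = i (p a) * b :=
  hA.eq_of_mul' fun c => by
    rw [← H.incl_proj_mul_comm, ← mul_assoc, H.incl_proj_mul_comm, mul_assoc]

theorem incl_proj_mul' (H : IsCorner i p) (hA : IsNondegenerateAlg A) (a b : A) :
    i (p (a * b)) = a * i (p b) := by
  rw [H.incl_proj_mul hA, H.incl_proj_mul_comm]

/-- All multipliers of `A` commute with the projection onto the direct factor. -/
theorem left_incl_proj (H : IsCorner i p) (hA : IsNondegenerateAlg A) (m : Mult k A) (a : A) :
    m.left (i (p a)) = i (p (m.left a)) :=
  hA.eq_of_mul' fun c => by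
    rw [m.central, ← H.incl_proj_mul' hA, ← m.central, H.incl_proj_mul' hA]

theorem right_incl_proj (H : IsCorner i p) (hA : IsNondegenerateAlg A) (m : Mult k A) (a : A) :
    m.right (i (p a)) = i (p (m.right a)) :=
  hA.eq_of_mul fun c => by
    rw [← m.central, ← H.incl_proj_mul hA, m.central, H.incl_proj_mul hA]

/-- The component of a multiplier of `A` in the direct factor. -/
def restrictMult (H : IsCorner i p) : Mult k A →ₗ[k] Mult k B where
  toFun m := Mult.mk (p ∘ₗ m.left ∘ₗ i) (p ∘ₗ m.right ∘ₗ i) (by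
    intro a b
    apply H.injective
    simp only [LinearMap.comp_apply]
    rw [← H.mul_incl, ← H.incl_mul, m.central])
  map_add' m n := by apply ext' <;> intro a <;> simp
  map_smul' c m := by apply ext' <;> intro a <;> simp

theorem incl_restrictMult_left (H : IsCorner i p) (hA : IsNondegenerateAlg A) (m : Mult k A)
    (b : B) : i ((H.restrictMult m).left b) = m.left (i b) := by
  change i (p (m.left (i b))) = m.left (i b)
  rw [← H.left_incl_proj hA, H.proj_incl]

theorem incl_restrictMult_right (H : IsCorner i p) (hA : IsNondegenerateAlg A) (m : Mult k A)
    (b : B) : i ((H.restrictMult m).right b) = m.right (i b) := by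
  change i (p (m.right (i b))) = m.right (i b)
  rw [← H.right_incl_proj hA, H.proj_incl]

/-- The comultiplication induced on a direct factor. -/
def restrictComul (H : IsCorner i p) (Δ : A →ₗ[k] Mult k (A ⊗[k] A)) :
    B →ₗ[k] Mult k (B ⊗[k] B) :=
  (H.tensor H).restrictMult ∘ₗ Δ ∘ₗ i

variable {Δ : A →ₗ[k] Mult k (A ⊗[k] A)}

theorem map_restrictComul_left (H : IsCorner i p) (hA : IsNondegenerateAlg A) (b : B)
    (x : B ⊗[k] B) : TensorProduct.map i i ((H.restrictComul Δ b).left x) =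
      (Δ (i b)).left (TensorProduct.map i i x) :=
  (H.tensor H).incl_restrictMult_left (hA.tensor hA) _ _

theorem map_restrictComul_right (H : IsCorner i p) (hA : IsNondegenerateAlg A) (b : B)
    (x : B ⊗[k] B) : TensorProduct.map i i ((H.restrictComul Δ b).right x) =
      (Δ (i b)).right (TensorProduct.map i i x) :=
  (H.tensor H).incl_restrictMult_right (hA.tensor hA) _ _

theorem map_id_mulLeft (H : IsCorner i p) (b : B) (x : B ⊗[k] B) :
    TensorProduct.map LinearMap.id (LinearMap.mulLeft k (i b)) (TensorProduct.map i i x) =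
      TensorProduct.map i i (TensorProduct.map LinearMap.id (LinearMap.mulLeft k b) x) := by
  induction x using TensorProduct.induction_on with
  | zero => simp
  | add x y hx hy => simp only [map_add, hx, hy]
  | tmul c d => simp [H.map_mul]

theorem map_mulLeft_id (H : IsCorner i p) (b : B) (x : B ⊗[k] B) :
    TensorProduct.map (LinearMap.mulLeft k (i b)) LinearMap.id (TensorProduct.map i i x) =
      TensorProduct.map i i (TensorProduct.map (LinearMap.mulLeft k b) LinearMap.id x) := by
  induction x using TensorProduct.induction_on with
  | zero => simp
  | add x y hx hy => simp only [map_add, hx, hy]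
  | tmul c d => simp [H.map_mul]

theorem map_id_mulRight (H : IsCorner i p) (b : B) (x : B ⊗[k] B) :
    TensorProduct.map LinearMap.id (LinearMap.mulRight k (i b)) (TensorProduct.map i i x) =
      TensorProduct.map i i (TensorProduct.map LinearMap.id (LinearMap.mulRight k b) x) := by
  induction x using TensorProduct.induction_on with
  | zero => simp
  | add x y hx hy => simp only [map_add, hx, hy]
  | tmul c d => simp [H.map_mul]

theorem map_mulRight_id (H : IsCorner i p) (b : B) (x : B ⊗[k] B) :
    TensorProduct.map (LinearMap.mulRight k (i b)) LinearMap.id (TensorProduct.map i i x) =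
      TensorProduct.map i i (TensorProduct.map (LinearMap.mulRight k b) LinearMap.id x) := by
  induction x using TensorProduct.induction_on with
  | zero => simp
  | add x y hx hy => simp only [map_add, hx, hy]
  | tmul c d => simp [H.map_mul]

/-- Covering passes to the direct factor without any compatibility between `Δ` and `e`: the factor
is an ideal, so the compression of `T₁(i b ⊗ i b')` acts on it exactly as `T₁(i b ⊗ i b')` does. -/
theorem incl_proj_T₁ (H : IsCorner i p) (hΔ : IsCovered Δ) (b b' : B) :
    incl (TensorProduct.map p p (T₁ Δ (i b ⊗ₜ i b'))) = H.restrictComul Δ b * snd B b' :=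
  ext_left ((H.tensor H).nondegenerate (hΔ.nondegenerate.tensor hΔ.nondegenerate)) fun x => by
    apply (H.tensor H).injective
    rw [incl_left, ← (H.tensor H).mul_incl, hΔ.T₁_mul, H.map_id_mulLeft, left_mul,
      H.map_restrictComul_left hΔ.nondegenerate]
    rfl

theorem incl_proj_T₂ (H : IsCorner i p) (hΔ : IsCovered Δ) (b b' : B) :
    incl (TensorProduct.map p p (T₂ Δ (i b ⊗ₜ i b'))) = fst B b * H.restrictComul Δ b' :=
  ext_right ((H.tensor H).nondegenerate (hΔ.nondegenerate.tensor hΔ.nondegenerate)) fun x => by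
    apply (H.tensor H).injective
    rw [incl_right, ← (H.tensor H).incl_mul, hΔ.mul_T₂, H.map_mulRight_id, right_mul,
      H.map_restrictComul_right hΔ.nondegenerate]
    rfl

theorem incl_proj_T₃ (H : IsCorner i p) (hΔ : IsCovered Δ) (b b' : B) :
    incl (TensorProduct.map p p (T₃ Δ (i b ⊗ₜ i b'))) = H.restrictComul Δ b * fst B b' :=
  ext_left ((H.tensor H).nondegenerate (hΔ.nondegenerate.tensor hΔ.nondegenerate)) fun x => by
    apply (H.tensor H).injective
    rw [incl_left, ← (H.tensor H).mul_incl, hΔ.T₃_mul, H.map_mulLeft_id, left_mul,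
      H.map_restrictComul_left hΔ.nondegenerate]
    rfl

theorem incl_proj_T₄ (H : IsCorner i p) (hΔ : IsCovered Δ) (b b' : B) :
    incl (TensorProduct.map p p (T₄ Δ (i b ⊗ₜ i b'))) = snd B b * H.restrictComul Δ b' :=
  ext_right ((H.tensor H).nondegenerate (hΔ.nondegenerate.tensor hΔ.nondegenerate)) fun x => by
    apply (H.tensor H).injective
    rw [incl_right, ← (H.tensor H).incl_mul, hΔ.mul_T₄, H.map_id_mulRight, right_mul,
      H.map_restrictComul_right hΔ.nondegenerate]
    rfl

theorem covered (H : IsCorner i p) (hΔ : IsCovered Δ) : IsCovered (H.restrictComul Δ) where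
  nondegenerate := H.nondegenerate hΔ.nondegenerate
  cover₁ b b' := ⟨_, H.incl_proj_T₁ hΔ b b'⟩
  cover₂ b b' := ⟨_, H.incl_proj_T₂ hΔ b b'⟩
  cover₃ b b' := ⟨_, H.incl_proj_T₃ hΔ b b'⟩
  cover₄ b b' := ⟨_, H.incl_proj_T₄ hΔ b b'⟩

theorem T₁_restrictComul (H : IsCorner i p) (hΔ : IsCovered Δ) (x : B ⊗[k] B) :
    T₁ (H.restrictComul Δ) x = TensorProduct.map p p (T₁ Δ (TensorProduct.map i i x)) := by
  induction x using TensorProduct.induction_on with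
  | zero => simp
  | add x y hx hy => simp only [map_add, hx, hy]
  | tmul b b' =>
    rw [← (H.covered hΔ).incl_inj, (H.covered hΔ).incl_T₁, TensorProduct.map_tmul,
      H.incl_proj_T₁ hΔ]

theorem T₂_restrictComul (H : IsCorner i p) (hΔ : IsCovered Δ) (x : B ⊗[k] B) :
    T₂ (H.restrictComul Δ) x = TensorProduct.map p p (T₂ Δ (TensorProduct.map i i x)) := by
  induction x using TensorProduct.induction_on with
  | zero => simp
  | add x y hx hy => simp only [map_add, hx, hy]
  | tmul b b' =>
    rw [← (H.covered hΔ).incl_inj, (H.covered hΔ).incl_T₂, TensorProduct.map_tmul,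
      H.incl_proj_T₂ hΔ]

/-- The central idempotent `e` that defines the direct factor satisfies
`(e ⊗ e)Δ(a) = Δ(e a)(e ⊗ 1) = Δ(e a)(1 ⊗ e)`. -/
structure IsCompatible (i : B →ₗ[k] A) (p : A →ₗ[k] B) (Δ : A →ₗ[k] Mult k (A ⊗[k] A)) :
    Prop where
  left_fst : ∀ a x, TensorProduct.map i i (TensorProduct.map p p ((Δ a).left x)) =
    (Δ (i (p a))).left (TensorProduct.map (i ∘ₗ p) LinearMap.id x)
  left_snd : ∀ a x, TensorProduct.map i i (TensorProduct.map p p ((Δ a).left x)) =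
    (Δ (i (p a))).left (TensorProduct.map LinearMap.id (i ∘ₗ p) x)
  right_fst : ∀ a x, TensorProduct.map i i (TensorProduct.map p p ((Δ a).right x)) =
    (Δ (i (p a))).right (TensorProduct.map (i ∘ₗ p) LinearMap.id x)
  right_snd : ∀ a x, TensorProduct.map i i (TensorProduct.map p p ((Δ a).right x)) =
    (Δ (i (p a))).right (TensorProduct.map LinearMap.id (i ∘ₗ p) x)

theorem isCompatible_of_equiv (e : B ≃ₗ[k] A) (Δ : A →ₗ[k] Mult k (A ⊗[k] A)) :
    IsCompatible e.toLinearMap e.symm.toLinearMap Δ := by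
  have h₁ : e.toLinearMap ∘ₗ e.symm.toLinearMap = LinearMap.id := LinearMap.ext (by simp)
  have h₂ : ∀ x, TensorProduct.map e.toLinearMap e.toLinearMap
      (TensorProduct.map e.symm.toLinearMap e.symm.toLinearMap x) = x := fun x => by
    rw [← LinearMap.comp_apply, ← TensorProduct.map_comp, h₁, TensorProduct.map_id,
      LinearMap.id_apply]
  constructor <;> intro a x <;> rw [h₂, h₁, TensorProduct.map_id] <;> simp

/-- This is where compatibility enters: `(e ⊗ e)Δ(a)(1 ⊗ b) = Δ(ea)(1 ⊗ e)(1 ⊗ b) = Δ(ea)(1 ⊗ eb)`.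
Thus `T₁` commutes with the projection onto the factor, and its bijectivity can be inherited. -/
theorem map_T₁ (H : IsCorner i p) (hΔ : IsCovered Δ) (hc : IsCompatible i p Δ) (x : A ⊗[k] A) :
    TensorProduct.map i i (TensorProduct.map p p (T₁ Δ x)) =
      T₁ Δ (TensorProduct.map i i (TensorProduct.map p p x)) := by
  have hn := hΔ.nondegenerate
  have hn2 : IsNondegenerateAlg (A ⊗[k] A) := hn.tensor hn
  induction x using TensorProduct.induction_on with
  | zero => simp
  | add x y hx hy => simp only [map_add, hx, hy]
  | tmul a b =>
    refine hn2.eq_of_mul fun z => ?_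
    rw [← (H.tensor H).incl_proj_mul hn2, hΔ.T₁_mul, hc.left_snd, TensorProduct.map_tmul,
      TensorProduct.map_tmul, hΔ.T₁_mul]
    congr 1
    rw [← LinearMap.comp_apply, ← TensorProduct.map_comp]
    congr 2
    exact LinearMap.ext fun c => H.incl_proj_mul hn b c

theorem map_T₂ (H : IsCorner i p) (hΔ : IsCovered Δ) (hc : IsCompatible i p Δ) (x : A ⊗[k] A) :
    TensorProduct.map i i (TensorProduct.map p p (T₂ Δ x)) =
      T₂ Δ (TensorProduct.map i i (TensorProduct.map p p x)) := by
  have hn := hΔ.nondegenerate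
  have hn2 : IsNondegenerateAlg (A ⊗[k] A) := hn.tensor hn
  induction x using TensorProduct.induction_on with
  | zero => simp
  | add x y hx hy => simp only [map_add, hx, hy]
  | tmul a b =>
    refine hn2.eq_of_mul' fun z => ?_
    rw [← (H.tensor H).incl_proj_mul' hn2, hΔ.mul_T₂, hc.right_fst, TensorProduct.map_tmul,
      TensorProduct.map_tmul, hΔ.mul_T₂]
    congr 1
    rw [← LinearMap.comp_apply, ← TensorProduct.map_comp]
    congr 2
    exact LinearMap.ext fun c => H.incl_proj_mul' hn c a

theorem map_T₁_restrictComul (H : IsCorner i p) (hΔ : IsCovered Δ) (hc : IsCompatible i p Δ)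
    (x : B ⊗[k] B) : TensorProduct.map i i (T₁ (H.restrictComul Δ) x) =
      T₁ Δ (TensorProduct.map i i x) := by
  rw [H.T₁_restrictComul hΔ, H.map_T₁ hΔ hc, (H.tensor H).proj_incl]

theorem map_T₂_restrictComul (H : IsCorner i p) (hΔ : IsCovered Δ) (hc : IsCompatible i p Δ)
    (x : B ⊗[k] B) : TensorProduct.map i i (T₂ (H.restrictComul Δ) x) =
      T₂ Δ (TensorProduct.map i i x) := by
  rw [H.T₂_restrictComul hΔ, H.map_T₂ hΔ hc, (H.tensor H).proj_incl]

/-- The embedding intertwines `T₁` and `T₂` of the factor with those of `A`, so its triple tensor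
power carries both sides of the identity to the corresponding sides in `A`; this power is injective.
-/
theorem isCoassociative (H : IsCorner i p) (hΔ : IsCovered Δ) (hc : IsCompatible i p Δ)
    (hco : IsCoassociative Δ) : IsCoassociative (H.restrictComul Δ) := by
  intro a b c
  apply (H.tensor (H.tensor H)).injective
  have h₁ : ∀ u v : B ⊗[k] B, u = v → ∀ c, TensorProduct.map i (TensorProduct.map i i)
      (TensorProduct.assoc k B B B (u ⊗ₜ c)) =
      TensorProduct.assoc k A A A (TensorProduct.map i i v ⊗ₜ i c) := by
    rintro u _ rfl c
    induction u using TensorProduct.induction_on with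
    | zero => simp
    | add x y hx hy => simp only [map_add, TensorProduct.add_tmul, hx, hy]
    | tmul c d => simp
  have h₂ : ∀ u : B ⊗[k] B, TensorProduct.map i (TensorProduct.map i i)
      (TensorProduct.assoc k B B B (TensorProduct.map (T₂ (H.restrictComul Δ)) LinearMap.id
        ((TensorProduct.assoc k B B B).symm (a ⊗ₜ u)))) =
      TensorProduct.assoc k A A A (TensorProduct.map (T₂ Δ) LinearMap.id
        ((TensorProduct.assoc k A A A).symm (i a ⊗ₜ TensorProduct.map i i u))) := by
    intro u
    induction u using TensorProduct.induction_on with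
    | zero => simp
    | add x y hx hy => simp only [map_add, TensorProduct.tmul_add, hx, hy]
    | tmul c d =>
      rw [TensorProduct.assoc_symm_tmul, TensorProduct.map_tmul, h₁ _ _ rfl,
        H.map_T₂_restrictComul hΔ hc]
      simp
  have h₃ : ∀ u : B ⊗[k] B, TensorProduct.map i (TensorProduct.map i i)
      (TensorProduct.map LinearMap.id (T₁ (H.restrictComul Δ))
        (TensorProduct.assoc k B B B (u ⊗ₜ c))) =
      TensorProduct.map LinearMap.id (T₁ Δ)
        (TensorProduct.assoc k A A A (TensorProduct.map i i u ⊗ₜ i c)) := by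
    intro u
    induction u using TensorProduct.induction_on with
    | zero => simp
    | add x y hx hy => simp only [map_add, TensorProduct.add_tmul, hx, hy]
    | tmul d e =>
      simp only [TensorProduct.assoc_tmul, TensorProduct.map_tmul, LinearMap.id_apply,
        H.map_T₁_restrictComul hΔ hc]
  rw [h₂, h₃, H.map_T₁_restrictComul hΔ hc, H.map_T₂_restrictComul hΔ hc]
  exact hco _ _ _

/-- With this, `p ⊗ p` maps `Δ(A)(A ⊗ A)` into the span of `Δ_B(B)(B ⊗ B)`, which gives
nondegeneracy of the induced comultiplication. -/
theorem proj_left (H : IsCorner i p) (hn : IsNondegenerateAlg A) (hc : IsCompatible i p Δ)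
    (a : A) (x : A ⊗[k] A) : TensorProduct.map p p ((Δ a).left x) =
      (H.restrictComul Δ (p a)).left (TensorProduct.map p p x) := by
  have hn2 : IsNondegenerateAlg (A ⊗[k] A) := hn.tensor hn
  apply (H.tensor H).injective
  rw [H.map_restrictComul_left hn, ← (H.tensor H).proj_incl (TensorProduct.map p p ((Δ a).left x)),
    ← (H.tensor H).left_incl_proj hn2, hc.left_fst]
  congr 1
  rw [← LinearMap.comp_apply, ← TensorProduct.map_comp]
  congr 2
  exact LinearMap.ext fun b => congrArg i (H.proj_incl b)

theorem proj_right (H : IsCorner i p) (hn : IsNondegenerateAlg A) (hc : IsCompatible i p Δ)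
    (a : A) (x : A ⊗[k] A) : TensorProduct.map p p ((Δ a).right x) =
      (H.restrictComul Δ (p a)).right (TensorProduct.map p p x) := by
  have hn2 : IsNondegenerateAlg (A ⊗[k] A) := hn.tensor hn
  apply (H.tensor H).injective
  rw [H.map_restrictComul_right hn,
    ← (H.tensor H).proj_incl (TensorProduct.map p p ((Δ a).right x)),
    ← (H.tensor H).right_incl_proj hn2, hc.right_fst]
  congr 1
  rw [← LinearMap.comp_apply, ← TensorProduct.map_comp]
  congr 2
  exact LinearMap.ext fun b => congrArg i (H.proj_incl b)

theorem isMultiplierBialgebra (H : IsCorner i p) (hΔ : IsMultiplierBialgebra Δ)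
    (hc : IsCompatible i p Δ) : IsMultiplierBialgebra (H.restrictComul Δ) where
  nondegenerate := H.nondegenerate hΔ.nondegenerate
  map_mul a b := ext_left ((H.covered hΔ.covered).nondegenerate.tensor
      (H.covered hΔ.covered).nondegenerate) fun x => (H.tensor H).injective (by
    simp only [left_mul, H.map_restrictComul_left hΔ.nondegenerate, H.map_mul, hΔ.map_mul])
  span_left := by
    refine eq_top_iff.2 fun z _ => ?_
    rw [← (H.tensor H).proj_incl z]
    have hz : TensorProduct.map i i z ∈ Submodule.span k {z | ∃ a x, z = (Δ a).left x} := by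
      rw [hΔ.span_left]; trivial
    generalize TensorProduct.map i i z = z' at hz
    induction hz using Submodule.span_induction with
    | mem w hw =>
      obtain ⟨a, x, rfl⟩ := hw
      exact Submodule.subset_span ⟨p a, _, H.proj_left hΔ.nondegenerate hc a x⟩
    | zero => rw [map_zero]; exact zero_mem _
    | add u v _ _ hu hv => rw [map_add]; exact add_mem hu hv
    | smul c u _ hu => rw [map_smul]; exact Submodule.smul_mem _ _ hu
  span_right := by
    refine eq_top_iff.2 fun z _ => ?_
    rw [← (H.tensor H).proj_incl z]
    have hz : TensorProduct.map i i z ∈ Submodule.span k {z | ∃ a x, z = (Δ a).right x} := by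
      rw [hΔ.span_right]; trivial
    generalize TensorProduct.map i i z = z' at hz
    induction hz using Submodule.span_induction with
    | mem w hw =>
      obtain ⟨a, x, rfl⟩ := hw
      exact Submodule.subset_span ⟨p a, _, H.proj_right hΔ.nondegenerate hc a x⟩
    | zero => rw [map_zero]; exact zero_mem _
    | add u v _ _ hu hv => rw [map_add]; exact add_mem hu hv
    | smul c u _ hu => rw [map_smul]; exact Submodule.smul_mem _ _ hu
  cover₁ := (H.covered hΔ.covered).cover₁
  cover₂ := (H.covered hΔ.covered).cover₂
  cover₃ := (H.covered hΔ.covered).cover₃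
  cover₄ := (H.covered hΔ.covered).cover₄
  coassoc := (H.covered hΔ.covered).isCoassociative_iff.1
    (H.isCoassociative hΔ.covered hc hΔ.isCoassociative)

theorem isMultiplierHopf (H : IsCorner i p) (hΔ : IsMultiplierHopf Δ)
    (hc : IsCompatible i p Δ) : IsMultiplierHopf (H.restrictComul Δ) where
  toIsMultiplierBialgebra := H.isMultiplierBialgebra hΔ.toIsMultiplierBialgebra hc
  bijective_T₁ := by
    refine ⟨fun x y hxy => (H.tensor H).injective (hΔ.bijective_T₁.1 ?_), fun z => ?_⟩
    · rw [← H.map_T₁_restrictComul hΔ.covered hc, hxy, H.map_T₁_restrictComul hΔ.covered hc]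
    · obtain ⟨x, hx⟩ := hΔ.bijective_T₁.2 (TensorProduct.map i i z)
      -- The preimage `x` is projected to the factor; this does not change its image, as `T₁`
      -- commutes with the projection and `(i ⊗ i)z` is fixed by it.
      refine ⟨TensorProduct.map p p x, (H.tensor H).injective ?_⟩
      rw [H.map_T₁_restrictComul hΔ.covered hc, ← H.map_T₁ hΔ.covered hc, hx,
        (H.tensor H).proj_incl]
  bijective_T₂ := by
    refine ⟨fun x y hxy => (H.tensor H).injective (hΔ.bijective_T₂.1 ?_), fun z => ?_⟩
    · rw [← H.map_T₂_restrictComul hΔ.covered hc, hxy, H.map_T₂_restrictComul hΔ.covered hc]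
    · obtain ⟨x, hx⟩ := hΔ.bijective_T₂.2 (TensorProduct.map i i z)
      refine ⟨TensorProduct.map p p x, (H.tensor H).injective ?_⟩
      rw [H.map_T₂_restrictComul hΔ.covered hc, ← H.map_T₂ hΔ.covered hc, hx,
        (H.tensor H).proj_incl]

theorem isHopfCounit (H : IsCorner i p) (hΔ : IsCovered Δ) (hc : IsCompatible i p Δ)
    {ε : A →ₗ[k] k} (hε : IsHopfCounit Δ ε) : IsHopfCounit (H.restrictComul Δ) (ε ∘ₗ i) :=
  fun a b => ⟨H.injective (by
      rw [← counitLeft_map, H.map_T₁_restrictComul hΔ hc, TensorProduct.map_tmul, (hε _ _).1,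
        H.map_mul]),
    H.injective (by
      rw [← counitRight_map, H.map_T₂_restrictComul hΔ hc, TensorProduct.map_tmul, (hε _ _).2,
        H.map_mul])⟩

end IsCorner

end Corner

/-! ### Tensor products of multiplier bialgebras. -/

section TensorBialgebra

variable {k : Type*} [Field k]
variable {R : Type*} [NonUnitalRing R] [Module k R] [SMulCommClass k R R] [IsScalarTower k R R]
variable {S : Type*} [NonUnitalRing S] [Module k S] [SMulCommClass k S S] [IsScalarTower k S S]
variable {Y : Type*} [NonUnitalRing Y] [Module k Y] [SMulCommClass k Y Y] [IsScalarTower k Y Y]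
variable {B : Type*} [NonUnitalRing B] [Module k B] [SMulCommClass k B B] [IsScalarTower k B B]

theorem Mult.congr_mul (e : R ≃ₗ[k] S) (he : ∀ x y, e (x * y) = e x * e y) (m n : Mult k R) :
    Mult.congr e he (m * n) = Mult.congr e he m * Mult.congr e he n := by
  apply ext' <;> intro x <;> simp [Mult.congr]

theorem Mult.tmul_one_one : tmul (1 : Mult k R) (1 : Mult k S) = 1 :=
  ext' (fun x => LinearMap.congr_fun (TensorProduct.map_id (R := k) (M := R) (N := S)) x)
    (fun x => LinearMap.congr_fun (TensorProduct.map_id (R := k) (M := R) (N := S)) x)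

/-- The interchange of the two middle factors, on multipliers. -/
def Mult.interchange : Mult k ((Y ⊗[k] Y) ⊗[k] (B ⊗[k] B)) →ₗ[k]
    Mult k ((Y ⊗[k] B) ⊗[k] (Y ⊗[k] B)) :=
  Mult.congr (TensorProduct.tensorTensorTensorComm k Y Y B B) tensorTensorTensorComm_mul

theorem Mult.interchange_mul (m n : Mult k ((Y ⊗[k] Y) ⊗[k] (B ⊗[k] B))) :
    interchange (m * n) = interchange m * interchange n :=
  congr_mul _ _ _ _

theorem Mult.interchange_tmul (m n : Mult k Y) (m' n' : Mult k B) :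
    interchange (tmul (tmul m n) (tmul m' n')) = tmul (tmul m m') (tmul n n') := by
  apply ext' <;> intro x <;>
    obtain ⟨x, rfl⟩ := (TensorProduct.tensorTensorTensorComm k Y Y B B).surjective x <;>
    simp only [interchange, Mult.congr, LinearMap.coe_mk, AddHom.coe_mk, left_mk, right_mk,
      LinearMap.comp_apply, LinearEquiv.coe_coe, LinearEquiv.symm_apply_apply, tmul_left,
      tmul_right] <;>
    induction x using TensorProduct.induction_on with
    | zero => simp
    | add x y hx hy => simp only [map_add, hx, hy]
    | tmul u v =>
      induction u using TensorProduct.induction_on with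
      | zero => simp
      | add x y hx hy => simp only [map_add, TensorProduct.add_tmul, hx, hy]
      | tmul a b =>
        induction v using TensorProduct.induction_on with
        | zero => simp
        | add x y hx hy => simp only [map_add, TensorProduct.tmul_add, hx, hy]
        | tmul c d => rfl

variable {ΔY : Y →ₗ[k] Mult k (Y ⊗[k] Y)} {ΔB : B →ₗ[k] Mult k (B ⊗[k] B)}

local notation "τ" => TensorProduct.tensorTensorTensorComm k Y Y B B

theorem tensorComul_tmul (y : Y) (b : B) : tensorComul ΔY ΔB (y ⊗ₜ b) =
    interchange (tmul (ΔY y) (ΔB b)) := rfl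

theorem tensorComul_left (y : Y) (b : B) (x : (Y ⊗[k] Y) ⊗[k] (B ⊗[k] B)) :
    (tensorComul ΔY ΔB (y ⊗ₜ b)).left (τ x) =
      τ (TensorProduct.map (ΔY y).left (ΔB b).left x) := by
  change τ (TensorProduct.map (ΔY y).left (ΔB b).left ((τ).symm (τ x))) = _
  rw [LinearEquiv.symm_apply_apply]

theorem tensorComul_right (y : Y) (b : B) (x : (Y ⊗[k] Y) ⊗[k] (B ⊗[k] B)) :
    (tensorComul ΔY ΔB (y ⊗ₜ b)).right (τ x) =
      τ (TensorProduct.map (ΔY y).right (ΔB b).right x) := by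
  change τ (TensorProduct.map (ΔY y).right (ΔB b).right ((τ).symm (τ x))) = _
  rw [LinearEquiv.symm_apply_apply]

theorem snd_tmul (y : Y) (b : B) : snd (k := k) (Y ⊗[k] B) (y ⊗ₜ[k] b) =
    interchange (tmul (snd Y y) (snd B b)) := by
  have := interchange_tmul 1 (incl (k := k) y) 1 (incl (k := k) b)
  rw [tmul_one_one, ← incl_tmul] at this
  exact this.symm

theorem fst_tmul (y : Y) (b : B) : fst (k := k) (Y ⊗[k] B) (y ⊗ₜ[k] b) =
    interchange (tmul (fst Y y) (fst B b)) := by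
  have := interchange_tmul (incl (k := k) y) 1 (incl (k := k) b) 1
  rw [tmul_one_one, ← incl_tmul] at this
  exact this.symm

theorem incl_tensorTensorTensorComm (u : Y ⊗[k] Y) (v : B ⊗[k] B) :
    incl (τ (u ⊗ₜ v)) =
      interchange (tmul (incl (k := k) u) (incl (k := k) v)) := by
  rw [← incl_tmul, interchange, congr_incl]

/-- Existence of covering elements need only be checked on elementary tensors. -/
theorem exists_incl_of_tmul {V W V' W' : Type*} [AddCommGroup V] [Module k V] [AddCommGroup W]
    [Module k W] [AddCommGroup V'] [Module k V'] [AddCommGroup W'] [Module k W']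
    (f : V ⊗[k] W →ₗ[k] Mult k R) (g : V' ⊗[k] W' →ₗ[k] Mult k R)
    (H : ∀ v w v' w', ∃ x, incl x = f (v ⊗ₜ w) * g (v' ⊗ₜ w')) (a : V ⊗[k] W)
    (b : V' ⊗[k] W') : ∃ x, incl x = f a * g b := by
  induction a using TensorProduct.induction_on with
  | zero => exact ⟨0, by simp⟩
  | add a a' ha ha' =>
    obtain ⟨x, hx⟩ := ha
    obtain ⟨x', hx'⟩ := ha'
    exact ⟨x + x', by simp only [map_add, add_mul, hx, hx']⟩
  | tmul v w =>
    induction b using TensorProduct.induction_on with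
    | zero => exact ⟨0, by simp⟩
    | add a a' ha ha' =>
      obtain ⟨x, hx⟩ := ha
      obtain ⟨x', hx'⟩ := ha'
      exact ⟨x + x', by simp only [map_add, mul_add, hx, hx']⟩
    | tmul v' w' => exact H v w v' w'

/-- The interchange of the middle factors is multiplicative on multipliers, and `1 ⊗ (y' ⊗ b')` is
the image of `(1 ⊗ y') ⊗ (1 ⊗ b')`, so the product splits into a `Y`-part and a `B`-part. -/
theorem IsCovered.incl_tensor_T₁ (hY : IsCovered ΔY) (hB : IsCovered ΔB) (y y' : Y) (b b' : B) :
    incl (τ (T₁ ΔY (y ⊗ₜ y') ⊗ₜ T₁ ΔB (b ⊗ₜ b'))) =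
      tensorComul ΔY ΔB (y ⊗ₜ b) * snd (Y ⊗[k] B) (y' ⊗ₜ[k] b') := by
  rw [incl_tensorTensorTensorComm, hY.incl_T₁, hB.incl_T₁, ← tmul_mul_tmul, interchange_mul, snd_tmul,
    tensorComul_tmul]

theorem IsCovered.incl_tensor_T₂ (hY : IsCovered ΔY) (hB : IsCovered ΔB) (y y' : Y) (b b' : B) :
    incl (τ (T₂ ΔY (y ⊗ₜ y') ⊗ₜ T₂ ΔB (b ⊗ₜ b'))) =
      fst (Y ⊗[k] B) (y ⊗ₜ[k] b) * tensorComul ΔY ΔB (y' ⊗ₜ b') := by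
  rw [incl_tensorTensorTensorComm, hY.incl_T₂, hB.incl_T₂, ← tmul_mul_tmul, interchange_mul, fst_tmul,
    tensorComul_tmul]

theorem IsCovered.incl_tensor_T₃ (hY : IsCovered ΔY) (hB : IsCovered ΔB) (y y' : Y) (b b' : B) :
    incl (τ (T₃ ΔY (y ⊗ₜ y') ⊗ₜ T₃ ΔB (b ⊗ₜ b'))) =
      tensorComul ΔY ΔB (y ⊗ₜ b) * fst (Y ⊗[k] B) (y' ⊗ₜ[k] b') := by
  rw [incl_tensorTensorTensorComm, hY.incl_T₃, hB.incl_T₃, ← tmul_mul_tmul, interchange_mul, fst_tmul,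
    tensorComul_tmul]

theorem IsCovered.incl_tensor_T₄ (hY : IsCovered ΔY) (hB : IsCovered ΔB) (y y' : Y) (b b' : B) :
    incl (τ (T₄ ΔY (y ⊗ₜ y') ⊗ₜ T₄ ΔB (b ⊗ₜ b'))) =
      snd (Y ⊗[k] B) (y ⊗ₜ[k] b) * tensorComul ΔY ΔB (y' ⊗ₜ b') := by
  rw [incl_tensorTensorTensorComm, hY.incl_T₄, hB.incl_T₄, ← tmul_mul_tmul, interchange_mul, snd_tmul,
    tensorComul_tmul]

theorem IsCovered.tensor (hY : IsCovered ΔY) (hB : IsCovered ΔB) :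
    IsCovered (tensorComul ΔY ΔB) where
  nondegenerate := hY.nondegenerate.tensor hB.nondegenerate
  cover₁ := exists_incl_of_tmul _ _ fun _ _ _ _ => ⟨_, hY.incl_tensor_T₁ hB _ _ _ _⟩
  cover₂ := exists_incl_of_tmul _ _ fun _ _ _ _ => ⟨_, hY.incl_tensor_T₂ hB _ _ _ _⟩
  cover₃ := exists_incl_of_tmul _ _ fun _ _ _ _ => ⟨_, hY.incl_tensor_T₃ hB _ _ _ _⟩
  cover₄ := exists_incl_of_tmul _ _ fun _ _ _ _ => ⟨_, hY.incl_tensor_T₄ hB _ _ _ _⟩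

theorem IsCovered.T₁_tensor (hY : IsCovered ΔY) (hB : IsCovered ΔB) (y y' : Y) (b b' : B) :
    T₁ (tensorComul ΔY ΔB) ((y ⊗ₜ b) ⊗ₜ (y' ⊗ₜ b')) =
      τ (T₁ ΔY (y ⊗ₜ y') ⊗ₜ T₁ ΔB (b ⊗ₜ b')) := by
  rw [← (hY.tensor hB).incl_inj, (hY.tensor hB).incl_T₁, hY.incl_tensor_T₁ hB]

theorem IsCovered.T₂_tensor (hY : IsCovered ΔY) (hB : IsCovered ΔB) (y y' : Y) (b b' : B) :
    T₂ (tensorComul ΔY ΔB) ((y ⊗ₜ b) ⊗ₜ (y' ⊗ₜ b')) =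
      τ (T₂ ΔY (y ⊗ₜ y') ⊗ₜ T₂ ΔB (b ⊗ₜ b')) := by
  rw [← (hY.tensor hB).incl_inj, (hY.tensor hB).incl_T₂, hY.incl_tensor_T₂ hB]

/-- The shuffle `(Y ⊗ (Y ⊗ Y)) ⊗ (B ⊗ (B ⊗ B)) → (Y ⊗ B) ⊗ ((Y ⊗ B) ⊗ (Y ⊗ B))`. -/
def tripleShuffle : (Y ⊗[k] (Y ⊗[k] Y)) ⊗[k] (B ⊗[k] (B ⊗[k] B)) →ₗ[k]
    (Y ⊗[k] B) ⊗[k] ((Y ⊗[k] B) ⊗[k] (Y ⊗[k] B)) :=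
  TensorProduct.map LinearMap.id (τ).toLinearMap ∘ₗ
    (TensorProduct.tensorTensorTensorComm k Y (Y ⊗[k] Y) B (B ⊗[k] B)).toLinearMap

theorem tripleShuffle_tmul (y : Y) (b : B) (u : Y ⊗[k] Y) (v : B ⊗[k] B) :
    tripleShuffle ((y ⊗ₜ[k] u) ⊗ₜ[k] (b ⊗ₜ[k] v)) = (y ⊗ₜ b) ⊗ₜ τ (u ⊗ₜ v) := by
  simp [tripleShuffle]

/-- A bilinear identity on `(Y ⊗ Y) ⊗ (B ⊗ B)` need only be checked on elementary tensors. -/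
theorem tensor_induction₂ {P : Y ⊗[k] Y → B ⊗[k] B → Prop}
    (zero_left : ∀ v, P 0 v) (zero_right : ∀ u, P u 0)
    (add_left : ∀ u u' v, P u v → P u' v → P (u + u') v)
    (add_right : ∀ u v v', P u v → P u v' → P u (v + v'))
    (tmul : ∀ y y' b b', P (y ⊗ₜ y') (b ⊗ₜ b')) (u : Y ⊗[k] Y) (v : B ⊗[k] B) : P u v := by
  induction u using TensorProduct.induction_on with
  | zero => exact zero_left _
  | add x y hx hy => exact add_left _ _ _ hx hy
  | tmul y y' =>
    induction v using TensorProduct.induction_on with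
    | zero => exact zero_right _
    | add x y hx hy => exact add_right _ _ _ hx hy
    | tmul b b' => exact tmul _ _ _ _

theorem assoc_tensorTensorTensorComm (y : Y) (b : B) (u : Y ⊗[k] Y) (v : B ⊗[k] B) :
    TensorProduct.assoc k _ _ _ (τ (u ⊗ₜ v) ⊗ₜ (y ⊗ₜ[k] b)) =
      tripleShuffle (TensorProduct.assoc k Y Y Y (u ⊗ₜ y) ⊗ₜ
        TensorProduct.assoc k B B B (v ⊗ₜ b)) := by
  induction u, v using tensor_induction₂ with
  | zero_left v => simp
  | zero_right u => simp
  | add_left u u' v h h' => simp only [TensorProduct.add_tmul, map_add, h, h']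
  | add_right u v v' h h' => simp only [TensorProduct.add_tmul, TensorProduct.tmul_add, map_add, h, h']
  | tmul y' y'' b' b'' =>
    simp [tripleShuffle_tmul]

theorem IsCovered.tensor_T₂_id (hY : IsCovered ΔY) (hB : IsCovered ΔB) (y : Y) (b : B)
    (u : Y ⊗[k] Y) (v : B ⊗[k] B) :
    TensorProduct.assoc k _ _ _ (TensorProduct.map (T₂ (tensorComul ΔY ΔB)) LinearMap.id
      ((TensorProduct.assoc k _ _ _).symm ((y ⊗ₜ[k] b) ⊗ₜ[k] τ (u ⊗ₜ v)))) =
    tripleShuffle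
      (TensorProduct.assoc k _ _ _ (TensorProduct.map (T₂ ΔY) LinearMap.id
        ((TensorProduct.assoc k _ _ _).symm (y ⊗ₜ u))) ⊗ₜ
      TensorProduct.assoc k _ _ _ (TensorProduct.map (T₂ ΔB) LinearMap.id
        ((TensorProduct.assoc k _ _ _).symm (b ⊗ₜ v)))) := by
  induction u, v using tensor_induction₂ with
  | zero_left v => simp
  | zero_right u => simp
  | add_left u u' v h h' => simp only [TensorProduct.add_tmul, TensorProduct.tmul_add, map_add, h, h']
  | add_right u v v' h h' => simp only [TensorProduct.tmul_add, map_add, h, h']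
  | tmul y' y'' b' b'' =>
    simp only [TensorProduct.tensorTensorTensorComm_tmul, TensorProduct.assoc_symm_tmul,
      TensorProduct.map_tmul, hY.T₂_tensor hB, LinearMap.id_apply, assoc_tensorTensorTensorComm]

theorem IsCovered.tensor_id_T₁ (hY : IsCovered ΔY) (hB : IsCovered ΔB) (y : Y) (b : B)
    (u : Y ⊗[k] Y) (v : B ⊗[k] B) :
    TensorProduct.map LinearMap.id (T₁ (tensorComul ΔY ΔB))
      (TensorProduct.assoc k _ _ _ (τ (u ⊗ₜ v) ⊗ₜ (y ⊗ₜ[k] b))) =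
    tripleShuffle
      (TensorProduct.map LinearMap.id (T₁ ΔY) (TensorProduct.assoc k _ _ _ (u ⊗ₜ y)) ⊗ₜ
      TensorProduct.map LinearMap.id (T₁ ΔB) (TensorProduct.assoc k _ _ _ (v ⊗ₜ b))) := by
  induction u, v using tensor_induction₂ with
  | zero_left v => simp
  | zero_right u => simp
  | add_left u u' v h h' => simp only [TensorProduct.add_tmul, map_add, h, h']
  | add_right u v v' h h' => simp only [TensorProduct.add_tmul, TensorProduct.tmul_add, map_add, h, h']
  | tmul y' y'' b' b'' =>
    simp only [TensorProduct.tensorTensorTensorComm_tmul, TensorProduct.assoc_tmul,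
      TensorProduct.map_tmul, hY.T₁_tensor hB, LinearMap.id_apply, tripleShuffle_tmul]

/-- On elementary tensors, both sides are the same shuffle of a `Y`-part tensored with a `B`-part,
and these are the two sides of coassociativity for `Y` and for `B`. -/
theorem IsCoassociative.tensor (hY : IsCovered ΔY) (hB : IsCovered ΔB)
    (cY : IsCoassociative ΔY) (cB : IsCoassociative ΔB) :
    IsCoassociative (tensorComul ΔY ΔB) := by
  intro a b c
  induction a using TensorProduct.induction_on with
  | zero => simp
  | add x y hx hy => simp only [map_add, TensorProduct.add_tmul, hx, hy]
  | tmul y₁ b₁ =>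
    induction b using TensorProduct.induction_on with
    | zero => simp
    | add x y hx hy => simp only [map_add, TensorProduct.add_tmul, TensorProduct.tmul_add, hx, hy]
    | tmul y₂ b₂ =>
      induction c using TensorProduct.induction_on with
      | zero => simp
      | add x y hx hy => simp only [map_add, TensorProduct.tmul_add, hx, hy]
      | tmul y₃ b₃ =>
        rw [hY.T₁_tensor hB, hY.T₂_tensor hB, hY.tensor_T₂_id hB, hY.tensor_id_T₁ hB, cY, cB]

theorem tensorComul_mul (hY : ∀ a b, ΔY (a * b) = ΔY a * ΔY b)
    (hB : ∀ a b, ΔB (a * b) = ΔB a * ΔB b) (x y : Y ⊗[k] B) :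
    tensorComul ΔY ΔB (x * y) = tensorComul ΔY ΔB x * tensorComul ΔY ΔB y := by
  induction x using TensorProduct.induction_on with
  | zero => simp
  | add x x' hx hx' => simp only [add_mul, map_add, hx, hx']
  | tmul a b =>
    induction y using TensorProduct.induction_on with
    | zero => simp
    | add y y' hy hy' => simp only [mul_add, map_add, hy, hy']
    | tmul c d =>
      rw [Algebra.TensorProduct.tmul_mul_tmul, tensorComul_tmul, tensorComul_tmul,
        tensorComul_tmul, ← interchange_mul, tmul_mul_tmul, hY, hB]

theorem tmul_mem_of_mem_span {V W Z : Type*} [AddCommGroup V] [Module k V] [AddCommGroup W]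
    [Module k W] [AddCommGroup Z] [Module k Z] {s : Set V} {t : Set W} (f : V ⊗[k] W →ₗ[k] Z)
    {q : Submodule k Z} (H : ∀ v ∈ s, ∀ w ∈ t, f (v ⊗ₜ w) ∈ q)
    {v : V} (hv : v ∈ Submodule.span k s) {w : W} (hw : w ∈ Submodule.span k t) :
    f (v ⊗ₜ w) ∈ q := by
  induction hv using Submodule.span_induction with
  | mem v hv =>
    induction hw using Submodule.span_induction with
    | mem w hw => exact H v hv w hw
    | zero => simp
    | add x y _ _ hx hy => rw [TensorProduct.tmul_add, map_add]; exact add_mem hx hy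
    | smul c x _ hx => rw [TensorProduct.tmul_smul, map_smul]; exact q.smul_mem _ hx
  | zero => simp
  | add x y _ _ hx hy => rw [TensorProduct.add_tmul, map_add]; exact add_mem hx hy
  | smul c x _ hx => rw [← TensorProduct.smul_tmul', map_smul]; exact q.smul_mem _ hx

theorem span_tensor_eq_top {s : Set (Y ⊗[k] Y)} {t : Set (B ⊗[k] B)}
    {r : Set ((Y ⊗[k] B) ⊗[k] (Y ⊗[k] B))} (hs : Submodule.span k s = ⊤)
    (ht : Submodule.span k t = ⊤) (H : ∀ u ∈ s, ∀ v ∈ t, τ (u ⊗ₜ v) ∈ r) :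
    Submodule.span k r = ⊤ := by
  refine eq_top_iff.2 fun z _ => ?_
  obtain ⟨z, rfl⟩ := (τ).surjective z
  induction z using TensorProduct.induction_on with
  | zero => simp
  | add x y hx hy => rw [map_add]; exact add_mem (hx trivial) (hy trivial)
  | tmul u v =>
    exact tmul_mem_of_mem_span (τ).toLinearMap
      (fun u hu v hv => Submodule.subset_span (H u hu v hv)) (hs ▸ trivial) (ht ▸ trivial)

theorem IsMultiplierBialgebra.tensor (hY : IsMultiplierBialgebra ΔY)
    (hB : IsMultiplierBialgebra ΔB) : IsMultiplierBialgebra (tensorComul ΔY ΔB) where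
  nondegenerate := hY.nondegenerate.tensor hB.nondegenerate
  map_mul := tensorComul_mul hY.map_mul hB.map_mul
  span_left := span_tensor_eq_top hY.span_left hB.span_left (by
    rintro _ ⟨y, x, rfl⟩ _ ⟨b, x', rfl⟩
    exact ⟨y ⊗ₜ b, τ (x ⊗ₜ x'), by rw [tensorComul_left, TensorProduct.map_tmul]⟩)
  span_right := span_tensor_eq_top hY.span_right hB.span_right (by
    rintro _ ⟨y, x, rfl⟩ _ ⟨b, x', rfl⟩
    exact ⟨y ⊗ₜ b, τ (x ⊗ₜ x'), by rw [tensorComul_right, TensorProduct.map_tmul]⟩)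
  cover₁ := (hY.covered.tensor hB.covered).cover₁
  cover₂ := (hY.covered.tensor hB.covered).cover₂
  cover₃ := (hY.covered.tensor hB.covered).cover₃
  cover₄ := (hY.covered.tensor hB.covered).cover₄
  coassoc := (hY.covered.tensor hB.covered).isCoassociative_iff.1
    (hY.isCoassociative.tensor hY.covered hB.covered hB.isCoassociative)

variable {εY : Y →ₗ[k] k} {εB : B →ₗ[k] k}

@[simp] theorem tensorCounit_tmul (y : Y) (b : B) :
    tensorCounit εY εB (y ⊗ₜ b) = εY y * εB b := rfl

theorem tensorCounit_mul (hY : ∀ a b, εY (a * b) = εY a * εY b)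
    (hB : ∀ a b, εB (a * b) = εB a * εB b) (x y : Y ⊗[k] B) :
    tensorCounit εY εB (x * y) = tensorCounit εY εB x * tensorCounit εY εB y := by
  induction x using TensorProduct.induction_on with
  | zero => simp
  | add x x' hx hx' => simp only [add_mul, map_add, hx, hx']
  | tmul a b =>
    induction y using TensorProduct.induction_on with
    | zero => simp
    | add y y' hy hy' => simp only [mul_add, map_add, hy, hy']
    | tmul c d =>
      simp only [Algebra.TensorProduct.tmul_mul_tmul, tensorCounit_tmul, hY, hB]
      ring

theorem counitLeft_tensorCounit (u : Y ⊗[k] Y) (v : B ⊗[k] B) :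
    counitLeft (tensorCounit εY εB) (τ (u ⊗ₜ v)) = counitLeft εY u ⊗ₜ counitLeft εB v := by
  induction u, v using tensor_induction₂ with
  | zero_left v => simp
  | zero_right u => simp
  | add_left u u' v h h' => simp only [TensorProduct.add_tmul, map_add, h, h']
  | add_right u v v' h h' => simp only [TensorProduct.tmul_add, map_add, h, h']
  | tmul y' y'' b' b'' =>
    rw [TensorProduct.tensorTensorTensorComm_tmul, counitLeft_tmul, counitLeft_tmul, counitLeft_tmul,
      tensorCounit_tmul, TensorProduct.smul_tmul_smul]

theorem counitRight_tensorCounit (u : Y ⊗[k] Y) (v : B ⊗[k] B) :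
    counitRight (tensorCounit εY εB) (τ (u ⊗ₜ v)) = counitRight εY u ⊗ₜ counitRight εB v := by
  induction u, v using tensor_induction₂ with
  | zero_left v => simp
  | zero_right u => simp
  | add_left u u' v h h' => simp only [TensorProduct.add_tmul, map_add, h, h']
  | add_right u v v' h h' => simp only [TensorProduct.tmul_add, map_add, h, h']
  | tmul y' y'' b' b'' =>
    rw [TensorProduct.tensorTensorTensorComm_tmul, counitRight_tmul, counitRight_tmul, counitRight_tmul,
      tensorCounit_tmul, TensorProduct.smul_tmul_smul]

theorem IsHopfCounit.tensor (hY : IsCovered ΔY) (hB : IsCovered ΔB) (eY : IsHopfCounit ΔY εY)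
    (eB : IsHopfCounit ΔB εB) : IsHopfCounit (tensorComul ΔY ΔB) (tensorCounit εY εB) := by
  intro x y
  induction x using TensorProduct.induction_on with
  | zero => simp
  | add x x' hx hx' =>
    simp only [TensorProduct.add_tmul, add_mul, map_add, hx.1, hx'.1, hx.2, hx'.2, and_self]
  | tmul a b =>
    induction y using TensorProduct.induction_on with
    | zero => simp
    | add y y' hy hy' =>
      simp only [TensorProduct.tmul_add, mul_add, map_add, hy.1, hy'.1, hy.2, hy'.2, and_self]
    | tmul c d =>
      rw [hY.T₁_tensor hB, hY.T₂_tensor hB, counitLeft_tensorCounit, counitRight_tensorCounit,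
        (eY _ _).1, (eB _ _).1, (eY _ _).2, (eB _ _).2, Algebra.TensorProduct.tmul_mul_tmul]
      exact ⟨rfl, rfl⟩

end TensorBialgebra

/-! ### The multiplier `h` as a central idempotent. -/

section GroupLike

variable {k : Type*} [Field k]
variable {A : Type*} [NonUnitalRing A] [Module k A] [SMulCommClass k A A] [IsScalarTower k A A]
variable {Δ : A →ₗ[k] Mult k (A ⊗[k] A)} {h : Mult k A}

/-- The default value of `extend` is `0`, so a nonzero value certifies that an extension exists. -/
theorem Mult.isExtension_extend {R S : Type*} [NonUnitalRing R] [Module k R]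
    [SMulCommClass k R R] [IsScalarTower k R R] [NonUnitalRing S] [Module k S]
    [SMulCommClass k S S] [IsScalarTower k S S] {φ : R →ₗ[k] Mult k S} {m : Mult k R}
    (H : extend φ m ≠ 0) : IsExtension φ m (extend φ m) := by
  by_cases hex : ∃ n, IsExtension φ m n
  · rw [extend, dif_pos hex]
    exact hex.choose_spec
  · exact absurd (by rw [extend, dif_neg hex]) H

theorem Mult.apply_left_of_extend_eq_one {ε : A →ₗ[k] k}
    (hε : extend (incl ∘ₗ ε) h = (1 : Mult k k)) (a : A) : ε (h.left a) = ε a := by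
  have h1 : (1 : Mult k k) ≠ 0 := fun H => one_ne_zero (α := k)
    (congrArg (fun m : Mult k k => m.left 1) H)
  have := (isExtension_extend (hε ▸ h1) a).1
  rw [hε, one_mul] at this
  have := congrArg (fun m : Mult k k => m.left 1) this
  simpa using this.symm

/-- A vanishing counit forces `ab = (ε ⊗ ι)T₁(a ⊗ b) = 0` for all `a` and `b`, hence `A = 0`. This
disposes of degenerate cases. -/
theorem IsHopfCounit.eq_zero_of_counit_eq_zero (hn : IsNondegenerateAlg A) {ε : A →ₗ[k] k}
    (hε : IsHopfCounit Δ ε) (h0 : ∀ a, ε a = 0) (a : A) : a = 0 := by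
  obtain rfl : ε = 0 := LinearMap.ext h0
  refine hn.1 a fun b => ?_
  rw [← (hε a b).1]
  generalize T₁ Δ (a ⊗ₜ b) = x
  induction x using TensorProduct.induction_on with
  | zero => simp
  | add x y hx hy => rw [map_add, hx, hy, add_zero]
  | tmul c d => simp

/-- It has to be excluded that `Δ(h)` is merely the default value `0`. In that case `h ⊗ h = 0`, and
`ε ⊗ ε` gives `ε(a)ε(b) = ε(ha)ε(hb) = 0`. Then `ε = 0`, so `A = 0` and the extension property is
trivial. -/
theorem isExtension_comul_of_counit (hn : IsNondegenerateAlg A) {ε : A →ₗ[k] k}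
    (hε : IsHopfCounit Δ ε) (hh : ∀ a, ε (h.left a) = ε a) {m : Mult k (A ⊗[k] A)}
    (hΔ : tmul h h = m * extend Δ h) : IsExtension Δ h (extend Δ h) := by
  by_cases h0 : extend Δ h = 0
  · rw [h0, mul_zero] at hΔ
    have key : ∀ a b, ε a * ε b = 0 := fun a b => by
      have := congrArg (fun m : Mult k (A ⊗[k] A) => ε (counitLeft ε (m.left (a ⊗ₜ b)))) hΔ
      have h0 : (0 : Mult k (A ⊗[k] A)).left (a ⊗ₜ b) = 0 := rfl
      simpa [hh, h0] using this
    have triv : ∀ a : A, a = 0 := hε.eq_zero_of_counit_eq_zero hn fun a =>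
      mul_self_eq_zero.1 (key a a)
    intro r
    rw [h0, triv r]
    simp
  · exact isExtension_extend h0

/-- The relations `(h ⊗ h)Δ(a) = (h ⊗ 1)Δ(ha) = (1 ⊗ h)Δ(ha)`, for a multiplier `h` with
`ε(ha) = ε(a)`. -/
structure IsGroupLikeProj (Δ : A →ₗ[k] Mult k (A ⊗[k] A)) (ε : A →ₗ[k] k) (h : Mult k A) :
    Prop where
  counit : ∀ a, ε (h.left a) = ε a
  comul_fst : ∀ a x, TensorProduct.map h.left h.left ((Δ a).left x) =
    TensorProduct.map h.left LinearMap.id ((Δ (h.left a)).left x)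
  comul_snd : ∀ a x, TensorProduct.map h.left h.left ((Δ a).left x) =
    TensorProduct.map LinearMap.id h.left ((Δ (h.left a)).left x)

theorem isGroupLikeProj_of_extend (hn : IsNondegenerateAlg A) {ε : A →ₗ[k] k}
    (hε : IsHopfCounit Δ ε) (hh : extend (incl ∘ₗ ε) h = (1 : Mult k k))
    (hΔ : tmul h h = tmul h 1 * extend Δ h) (hΔ' : tmul h h = tmul 1 h * extend Δ h) :
    IsGroupLikeProj Δ ε h := by
  have hcu := apply_left_of_extend_eq_one hh
  have hE := isExtension_comul_of_counit hn hε hcu hΔ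
  refine ⟨hcu, fun a x => ?_, fun a x => ?_⟩
  · have : tmul h h * Δ a = tmul h 1 * Δ (h.left a) := by rw [hΔ, mul_assoc, (hE a).1]
    exact congrArg (fun m => Mult.left m x) this
  · have : tmul h h * Δ a = tmul 1 h * Δ (h.left a) := by rw [hΔ', mul_assoc, (hE a).1]
    exact congrArg (fun m => Mult.left m x) this

namespace IsGroupLikeProj

variable {ε : A →ₗ[k] k}

/-- Idempotency of `h`: multiply `(h ⊗ h)Δ(a) = (1 ⊗ h)Δ(ha)` by `1 ⊗ b` and apply `ε ⊗ ι`. Since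
`ε(h · ) = ε`, the outcome is `h(ab) = h(ha · b)`. -/
theorem left_left (H : IsGroupLikeProj Δ ε h) (hΔ : IsCovered Δ) (hε : IsHopfCounit Δ ε) (a : A) :
    h.left (h.left a) = h.left a := by
  have hn := hΔ.nondegenerate
  have hn2 : IsNondegenerateAlg (A ⊗[k] A) := hn.tensor hn
  have key : ∀ b, TensorProduct.map LinearMap.id h.left (T₁ Δ (h.left a ⊗ₜ b)) =
      TensorProduct.map h.left h.left (T₁ Δ (a ⊗ₜ b)) := fun b =>
    hn2.eq_of_mul fun x => by
      have e₁ := left_mul_apply hn2 (tmul 1 h) (T₁ Δ (h.left a ⊗ₜ b)) x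
      have e₂ := left_mul_apply hn2 (tmul h h) (T₁ Δ (a ⊗ₜ b)) x
      rw [hΔ.T₁_mul, tmul_left, tmul_left] at e₁ e₂
      rw [H.comul_snd] at e₂
      exact e₁.symm.trans e₂
  refine hn.eq_of_mul fun b => ?_
  have := congrArg (counitLeft ε) (key b)
  rw [counitLeft_map, counitLeft_map, LinearMap.comp_id,
    show ε ∘ₗ h.left = ε from LinearMap.ext H.counit, (hε _ _).1, (hε _ _).1,
    left_mul_apply hn, left_mul_apply hn] at this
  exact this

end IsGroupLikeProj

variable (hn : IsNondegenerateAlg A)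

/-- The projection `A → hA`, `a ↦ ha`. -/
def leftIdealProj (h : Mult k A) : A →ₗ[k] leftIdeal hn h where
  toFun a := ⟨h.left a, a, rfl⟩
  map_add' a b := Subtype.ext (map_add _ a b)
  map_smul' c a := Subtype.ext (map_smul _ c a)

theorem inclusion_leftIdealProj (h : Mult k A) :
    inclusion (leftIdeal hn h) ∘ₗ leftIdealProj hn h = h.left := rfl

variable {hn}

theorem left_inclusion_leftIdeal (hi : ∀ a, h.left (h.left a) = h.left a) (b : leftIdeal hn h) :
    h.left (inclusion (leftIdeal hn h) b) = inclusion (leftIdeal hn h) b := by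
  obtain ⟨_, a, rfl⟩ := b
  exact hi a

/-- Commutativity of `A` makes the idempotent `h` central, so that `a · hb = ha · hb` on either
side. -/
theorem isCorner_leftIdeal (hi : ∀ a, h.left (h.left a) = h.left a)
    (hcomm : ∀ a b : A, a * b = b * a) :
    IsCorner (inclusion (leftIdeal hn h)) (leftIdealProj hn h) where
  proj_incl b := Subtype.ext (left_inclusion_leftIdeal hi b)
  map_mul _ _ := rfl
  mul_incl a b := by
    change a * inclusion _ b = h.left a * inclusion _ b
    rw [← left_mul_apply hn, hcomm a, left_mul_apply hn, left_inclusion_leftIdeal hi]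
  incl_mul b a := by
    change inclusion _ b * a = inclusion _ b * h.left a
    rw [hcomm _ (h.left a), ← left_mul_apply hn, hcomm a, left_mul_apply hn,
      left_inclusion_leftIdeal hi]

/-- The relations for `h` have `h` to the left of `Δ(ha)`, whereas compatibility needs it on the
right. In the commutative algebra `A ⊗ A` all multipliers commute and their left and right actions
agree, so all four forms coincide with the two given ones. -/
theorem IsGroupLikeProj.isCompatible {ε : A →ₗ[k] k} (H : IsGroupLikeProj Δ ε h)
    (hcomm : ∀ a b : A, a * b = b * a) :
    IsCorner.IsCompatible (inclusion (leftIdeal hn h)) (leftIdealProj hn h) Δ := by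
  have hn2 : IsNondegenerateAlg (A ⊗[k] A) := hn.tensor hn
  have hc2 := tensor_mul_comm (k := k) hcomm hcomm
  have e : ∀ x, TensorProduct.map (inclusion (leftIdeal hn h)) (inclusion (leftIdeal hn h))
      (TensorProduct.map (leftIdealProj hn h) (leftIdealProj hn h) x) =
      TensorProduct.map h.left h.left x := fun x => by
    rw [← LinearMap.comp_apply, ← TensorProduct.map_comp, inclusion_leftIdealProj]
  have h₁ : ∀ a x, TensorProduct.map h.left h.left ((Δ a).left x) =
      (Δ (h.left a)).left (TensorProduct.map h.left LinearMap.id x) := fun a x => by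
    rw [H.comul_fst]
    exact left_left_comm hn2 hc2 (tmul h 1) _ x
  have h₂ : ∀ a x, TensorProduct.map h.left h.left ((Δ a).left x) =
      (Δ (h.left a)).left (TensorProduct.map LinearMap.id h.left x) := fun a x => by
    rw [H.comul_snd]
    exact left_left_comm hn2 hc2 (tmul 1 h) _ x
  constructor <;> intro a x <;> rw [e, inclusion_leftIdealProj]
  · exact h₁ a x
  · exact h₂ a x
  · rw [right_eq_left hn2 hc2, right_eq_left hn2 hc2]
    exact h₁ a x
  · rw [right_eq_left hn2 hc2, right_eq_left hn2 hc2]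
    exact h₂ a x

end GroupLike

/-! ### Uniqueness of the restricted comultiplication. -/

section Restriction

variable {k : Type*} [Field k]
variable {A : Type*} [NonUnitalRing A] [Module k A] [SMulCommClass k A A] [IsScalarTower k A A]
variable {Δ : A →ₗ[k] Mult k (A ⊗[k] A)} {S : NonUnitalSubalgebra k A}
  {ΔS : S →ₗ[k] Mult k (S ⊗[k] S)}

theorem map_inclusion_injective (S : NonUnitalSubalgebra k A) :
    Function.Injective (TensorProduct.map (inclusion S) (inclusion S)) :=
  TensorProduct.map_injective_of_flat_flat _ _ Subtype.val_injective Subtype.val_injective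

/-- Over a field `S ⊗ S → A ⊗ A` is injective, so the action on `A ⊗ A` leaves at most one
restriction. -/
theorem IsRestriction.restrictComul_eq (H : IsRestriction Δ S ΔS) : restrictComul Δ S = ΔS := by
  have hex : ∃ ΔS, IsRestriction Δ S ΔS := ⟨ΔS, H⟩
  rw [restrictComul, dif_pos hex]
  refine LinearMap.ext fun s => ext' (fun x => map_inclusion_injective S ?_)
    fun x => map_inclusion_injective S ?_
  · rw [(hex.choose_spec s x).1, (H s x).1]
  · rw [(hex.choose_spec s x).2, (H s x).2]

end Restriction

/-! ### Recovering the multiplier `Δ(a)` from the maps `T₁`, `T₂`, `T₃`, `T₄`. -/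

section CoverAction

variable {k : Type*} [Field k]
variable {A : Type*} [NonUnitalRing A] [Module k A] [SMulCommClass k A A] [IsScalarTower k A A]
variable {B : Type*} [NonUnitalRing B] [Module k B] [SMulCommClass k B B] [IsScalarTower k B B]
variable {Δ : A →ₗ[k] Mult k (A ⊗[k] A)}

theorem Mult.mul_incl_eq {R : Type*} [NonUnitalRing R] [Module k R] [SMulCommClass k R R]
    [IsScalarTower k R R] (hR : IsNondegenerateAlg R) (m : Mult k R) (x : R) :
    m * incl x = incl (m.left x) :=
  ext_left hR fun y => left_mul_apply hR m x y

theorem Mult.incl_mul_eq {R : Type*} [NonUnitalRing R] [Module k R] [SMulCommClass k R R]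
    [IsScalarTower k R R] (hR : IsNondegenerateAlg R) (m : Mult k R) (x : R) :
    incl x * m = incl (m.right x) :=
  ext_right hR fun y => right_mul_apply hR m y x

theorem snd_mul_fst (a : A) (b : B) : snd A b * fst B a = incl (a ⊗ₜ[k] b) := by
  rw [incl_tmul]
  exact (tmul_mul_tmul _ _ _ _).trans (by rw [one_mul, mul_one])

theorem fst_mul_snd (a : A) (b : B) : fst B a * snd A b = incl (a ⊗ₜ[k] b) := by
  rw [incl_tmul]
  exact (tmul_mul_tmul _ _ _ _).trans (by rw [one_mul, mul_one])

namespace IsCovered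

theorem map_mulRight_id_T₁ (H : IsCovered Δ) (a b c : A) :
    TensorProduct.map (LinearMap.mulRight k b) LinearMap.id (T₁ Δ (a ⊗ₜ c)) =
      (Δ a).left (b ⊗ₜ c) := by
  rw [← H.incl_inj, ← incl_mul_fst, H.incl_T₁, mul_assoc, snd_mul_fst,
    mul_incl_eq (H.nondegenerate.tensor H.nondegenerate)]

theorem map_id_mulRight_T₃ (H : IsCovered Δ) (a b c : A) :
    TensorProduct.map LinearMap.id (LinearMap.mulRight k c) (T₃ Δ (a ⊗ₜ b)) =
      (Δ a).left (b ⊗ₜ c) := by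
  rw [← H.incl_inj, ← incl_mul_snd, H.incl_T₃, mul_assoc, fst_mul_snd,
    mul_incl_eq (H.nondegenerate.tensor H.nondegenerate)]

theorem map_id_mulLeft_T₂ (H : IsCovered Δ) (a b c : A) :
    TensorProduct.map LinearMap.id (LinearMap.mulLeft k c) (T₂ Δ (b ⊗ₜ a)) =
      (Δ a).right (b ⊗ₜ c) := by
  rw [← H.incl_inj, ← snd_mul_incl, H.incl_T₂, ← mul_assoc, snd_mul_fst,
    incl_mul_eq (H.nondegenerate.tensor H.nondegenerate)]

theorem map_mulLeft_id_T₄ (H : IsCovered Δ) (a b c : A) :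
    TensorProduct.map (LinearMap.mulLeft k b) LinearMap.id (T₄ Δ (c ⊗ₜ a)) =
      (Δ a).right (b ⊗ₜ c) := by
  rw [← H.incl_inj, ← fst_mul_incl, H.incl_T₄, ← mul_assoc, fst_mul_snd,
    incl_mul_eq (H.nondegenerate.tensor H.nondegenerate)]

end IsCovered

/-- `(ι ⊗ ε)(Δ(a)(1 ⊗ b)) = ε(b) a`. -/
theorem IsHopfCounit.counitRight_T₁ (H : IsCovered Δ) {ε : A →ₗ[k] k} (hε : IsHopfCounit Δ ε)
    (hmul : ∀ a b, ε (a * b) = ε a * ε b) (a b : A) :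
    counitRight ε (T₁ Δ (a ⊗ₜ b)) = ε b • a := by
  refine H.nondegenerate.eq_of_mul' fun c => ?_
  -- Covering by `c ⊗ 1` replaces `T₁` by `T₂`, for which the counit equation is known: `(c ⊗ 1)T₁(a
  -- ⊗ b) = T₂(c ⊗ a)(1 ⊗ b)`. Multiplicativity of `ε` then extracts the factor `ε(b)`.
  have := congrArg (counitRight ε) (H.map_mulLeft_T₁ a b c)
  rw [counitRight_map, counitRight_map, LinearMap.comp_id,
    show ε ∘ₗ LinearMap.mulRight k b = ε b • ε from
      LinearMap.ext fun x => (hmul x b).trans (mul_comm _ _)] at this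
  have h2 : counitRight (ε b • ε) (T₂ Δ (c ⊗ₜ a)) = ε b • counitRight ε (T₂ Δ (c ⊗ₜ a)) := by
    generalize T₂ Δ (c ⊗ₜ a) = x
    induction x using TensorProduct.induction_on with
    | zero => simp
    | add x y hx hy => simp only [map_add, smul_add, hx, hy]
    | tmul p q => simp [mul_smul]
  rw [h2, (hε _ _).2] at this
  rw [mul_smul_comm]
  exact this

end CoverAction

/-! ### The smash comultiplication for the coaction `y ↦ h ⊗ y`. -/

section Smash

variable {k : Type*} [Field k]
variable {A : Type*} [NonUnitalRing A] [Module k A] [SMulCommClass k A A] [IsScalarTower k A A]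
variable {Y : Type*} [NonUnitalRing Y] [Module k Y] [SMulCommClass k Y Y] [IsScalarTower k Y Y]
variable {ΔA : A →ₗ[k] Mult k (A ⊗[k] A)} {ΔY : Y →ₗ[k] Mult k (Y ⊗[k] Y)}

local notation "τ" => TensorProduct.tensorTensorTensorComm k Y Y A A

/-- The defining formulas prescribe both components of each multiplier on elementary tensors, hence
everywhere. -/
theorem IsSmashComul.smashComul_eq {ρ : Y →ₗ[k] Mult k (A ⊗[k] Y)}
    {D : Y ⊗[k] A →ₗ[k] Mult k ((Y ⊗[k] A) ⊗[k] (Y ⊗[k] A))} (H : IsSmashComul ΔY ΔA ρ D) :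
    smashComul ΔY ΔA ρ = D := by
  have hex : ∃ D, IsSmashComul ΔY ΔA ρ D := ⟨D, H⟩
  rw [smashComul, dif_pos hex]
  have H' := hex.choose_spec
  refine TensorProduct.ext' fun y a => ext' (fun x => ?_) fun x => ?_
  all_goals
    induction x using TensorProduct.induction_on with
    | zero => simp
    | add x y hx hy => simp only [map_add, hx, hy]
    | tmul u v =>
      induction u using TensorProduct.induction_on with
      | zero => simp
      | add x y hx hy => simp only [map_add, TensorProduct.add_tmul, hx, hy]
      | tmul y' a' =>
        induction v using TensorProduct.induction_on with
        | zero => simp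
        | add x y hx hy => simp only [map_add, TensorProduct.tmul_add, hx, hy]
        | tmul y'' a'' =>
          first
          | exact (H' y y' y'' a a' a'').1.trans (H y y' y'' a a' a'').1.symm
          | exact (H' y y' y'' a a' a'').2.trans (H y y' y'' a a' a'').2.symm

theorem coactionT_constCoaction (hY : IsNondegenerateAlg Y) (hA : IsNondegenerateAlg A)
    (h : Mult k A) (y : Y) (a : A) :
    coactionT (constCoaction Y h) (y ⊗ₜ a) = h.left a ⊗ₜ y := by
  have key : ∀ (y : Y) (a : A), incl (h.left a ⊗ₜ[k] y) =
      prodMap (constCoaction Y h) (fst Y) (y ⊗ₜ[k] a) := fun y a => by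
    rw [incl_tmul, ← mul_incl_eq hA, ← mul_one (incl (k := k) y), ← tmul_mul_tmul]
    rfl
  apply incl_injective (k := k) (hA.tensor hY)
  rw [key]
  exact incl_corestrict (hA.tensor hY) _ (fun y a => ⟨_, key y a⟩) _

theorem midT_tmul (T : Y ⊗[k] A →ₗ[k] A ⊗[k] Y) {f : A →ₗ[k] A}
    (hT : ∀ y a, T (y ⊗ₜ a) = f a ⊗ₜ y) (u : Y ⊗[k] Y) (v : A ⊗[k] A) :
    midT T (u ⊗ₜ v) = τ (u ⊗ₜ TensorProduct.map f LinearMap.id v) := by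
  induction u, v using tensor_induction₂ with
  | zero_left v => simp
  | zero_right u => simp
  | add_left u u' v h h' => simp only [TensorProduct.add_tmul, map_add, h, h']
  | add_right u v v' h h' => simp only [TensorProduct.tmul_add, map_add, h, h']
  | tmul y y' a a' => simp [midT, hT]

theorem map_map_tensorTensorTensorComm (f g : Y →ₗ[k] Y) (f' g' : A →ₗ[k] A) (u : Y ⊗[k] Y)
    (v : A ⊗[k] A) :
    TensorProduct.map (TensorProduct.map f f') (TensorProduct.map g g') (τ (u ⊗ₜ v)) =
      τ (TensorProduct.map f g u ⊗ₜ TensorProduct.map f' g' v) := by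
  induction u, v using tensor_induction₂ with
  | zero_left v => simp
  | zero_right u => simp
  | add_left u u' v h h' => simp only [TensorProduct.add_tmul, map_add, h, h']
  | add_right u v v' h h' => simp only [TensorProduct.tmul_add, map_add, h, h']
  | tmul y y' a a' => simp

/-- The comultiplication `y ⊗ a ↦ (1 ⊗ h ⊗ 1 ⊗ 1)(ι ⊗ τ ⊗ ι)(Δ_Y(y) ⊗ Δ_A(a))` of the smash
coproduct with respect to the coaction `y ↦ h ⊗ y`. -/
def twistedComul (ΔY : Y →ₗ[k] Mult k (Y ⊗[k] Y)) (ΔA : A →ₗ[k] Mult k (A ⊗[k] A))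
    (h : Mult k A) : Y ⊗[k] A →ₗ[k] Mult k ((Y ⊗[k] A) ⊗[k] (Y ⊗[k] A)) :=
  LinearMap.mulLeft k (tmul (tmul 1 h) 1) ∘ₗ tensorComul ΔY ΔA

theorem twistedComul_apply (h : Mult k A) (x : Y ⊗[k] A) :
    twistedComul ΔY ΔA h x = tmul (tmul 1 h) 1 * tensorComul ΔY ΔA x := rfl

theorem map_twist_tensorTensorTensorComm (f : A →ₗ[k] A) (u : Y ⊗[k] Y) (v : A ⊗[k] A) :
    TensorProduct.map (TensorProduct.map LinearMap.id f) LinearMap.id (τ (u ⊗ₜ v)) =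
      τ (u ⊗ₜ TensorProduct.map f LinearMap.id v) := by
  have := map_map_tensorTensorTensorComm (LinearMap.id : Y →ₗ[k] Y) LinearMap.id f
    (LinearMap.id : A →ₗ[k] A) u v
  rwa [TensorProduct.map_id, TensorProduct.map_id, LinearMap.id_apply] at this

theorem twistedComul_left (h : Mult k A) (y : Y) (a : A) (u : Y ⊗[k] Y) (v : A ⊗[k] A) :
    (twistedComul ΔY ΔA h (y ⊗ₜ a)).left (τ (u ⊗ₜ v)) =
      τ ((ΔY y).left u ⊗ₜ TensorProduct.map h.left LinearMap.id ((ΔA a).left v)) := by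
  rw [twistedComul_apply, left_mul, tensorComul_left, TensorProduct.map_tmul]
  exact map_twist_tensorTensorTensorComm _ _ _

theorem twistedComul_right (h : Mult k A) (y : Y) (a : A) (u : Y ⊗[k] Y) (v : A ⊗[k] A) :
    (twistedComul ΔY ΔA h (y ⊗ₜ a)).right (τ (u ⊗ₜ v)) =
      τ ((ΔY y).right u ⊗ₜ (ΔA a).right (TensorProduct.map h.right LinearMap.id v)) := by
  rw [twistedComul_apply, right_mul]
  have : (tmul (tmul 1 h) 1).right (τ (u ⊗ₜ v)) =
    τ (u ⊗ₜ TensorProduct.map h.right LinearMap.id v) := map_twist_tensorTensorTensorComm _ _ _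
  rw [this, tensorComul_right, TensorProduct.map_tmul]

/-- As `T(y ⊗ a) = ha ⊗ y`, the map `ι ⊗ T ⊗ ι` is the interchange `τ` with `h` acting on the first
`A`-leg. The outer factors `a'` and `y''` complete `T₃` and `T₁`, respectively `T₂` and `T₄`, to the
full action of `Δ_Y(y)` and `Δ_A(a)`. -/
theorem isSmashComul_twistedComul (hY : IsCovered ΔY) (hA : IsCovered ΔA)
    (h : Mult k A) : IsSmashComul ΔY ΔA (constCoaction Y h) (twistedComul ΔY ΔA h) := by
  intro y y' y'' a a' a''
  have hτ : (y' ⊗ₜ[k] a') ⊗ₜ[k] (y'' ⊗ₜ[k] a'') = τ ((y' ⊗ₜ y'') ⊗ₜ (a' ⊗ₜ a'')) := rfl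
  rw [hτ, twistedComul_left, twistedComul_right,
    midT_tmul _ (coactionT_constCoaction hY.nondegenerate hA.nondegenerate h),
    midT_tmul _ (coactionT_constCoaction hY.nondegenerate hA.nondegenerate h)]
  constructor
  · rw [← hY.map_id_mulRight_T₃, ← hA.map_mulRight_id_T₁]
    refine Eq.trans ?_ (map_map_tensorTensorTensorComm _ _ _ _ _ _).symm
    congr 2
    generalize T₁ ΔA (a ⊗ₜ a'') = z
    rw [← LinearMap.comp_apply, ← LinearMap.comp_apply, ← TensorProduct.map_comp,
      ← TensorProduct.map_comp]
    congr 2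
    exact LinearMap.ext fun c => left_mul_apply hA.nondegenerate h c a'
  · rw [TensorProduct.map_tmul, LinearMap.id_apply, ← hY.map_id_mulLeft_T₂,
      ← hA.map_mulLeft_id_T₄]
    refine Eq.trans ?_ (map_map_tensorTensorTensorComm _ _ _ _ _ _).symm
    congr 2
    generalize T₄ ΔA (a'' ⊗ₜ a) = z
    rw [← LinearMap.comp_apply, ← TensorProduct.map_comp]
    congr 2
    -- The multiplier `h` stands to the left of `Δ_A(a)` in both formulas; acting from the right it
    -- is absorbed as `(a'h)c = a'(hc)`, which needs no commutativity.
    exact LinearMap.ext fun c => (h.central a' c).symm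

theorem T₁_twistedComul (hY : IsCovered ΔY) (hA : IsCovered ΔA) (h : Mult k A)
    (x : (Y ⊗[k] A) ⊗[k] (Y ⊗[k] A)) : T₁ (twistedComul ΔY ΔA h) x =
      TensorProduct.map (TensorProduct.map LinearMap.id h.left) LinearMap.id
        (T₁ (tensorComul ΔY ΔA) x) := by
  have hC := hY.tensor hA
  have hn2 := hC.nondegenerate.tensor (k := k) hC.nondegenerate
  have key : ∀ a b, incl (TensorProduct.map (TensorProduct.map LinearMap.id h.left) LinearMap.id
      (T₁ (tensorComul ΔY ΔA) (a ⊗ₜ b))) =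
      prodMap (twistedComul ΔY ΔA h) (snd (Y ⊗[k] A)) (a ⊗ₜ b) := fun a b => by
    have := mul_incl_eq hn2 (tmul (tmul 1 h) 1) (T₁ (tensorComul ΔY ΔA) (a ⊗ₜ b))
    rw [hC.incl_T₁, ← mul_assoc] at this
    exact this.symm
  induction x using TensorProduct.induction_on with
  | zero => simp
  | add x y hx hy => simp only [map_add, hx, hy]
  | tmul a b =>
    apply incl_injective (k := k) hn2
    rw [key]
    exact incl_corestrict hn2 _ (fun a b => ⟨_, key a b⟩) _

/-- The underlying space of the partial smash coproduct is `Y ⊗ hA`. -/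
theorem counitalPart_twistedComul (hY : IsCovered ΔY) (hA : IsCovered ΔA) {εY : Y →ₗ[k] k}
    {εA : A →ₗ[k] k} (eY : IsHopfCounit ΔY εY) (eA : IsHopfCounit ΔA εA)
    (mY : ∀ a b, εY (a * b) = εY a * εY b) (mA : ∀ a b, εA (a * b) = εA a * εA b) (h : Mult k A) :
    counitalPart (twistedComul ΔY ΔA h) (tensorCounit εY εA) =
      LinearMap.range (TensorProduct.map LinearMap.id h.left : Y ⊗[k] A →ₗ[k] Y ⊗[k] A) := by
  have hC := hY.tensor hA
  have eC := eY.tensor hY hA eA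
  have mC := tensorCounit_mul mY mA
  have key : ∀ c b, counitRight (tensorCounit εY εA) (T₁ (twistedComul ΔY ΔA h) (c ⊗ₜ b)) =
      tensorCounit εY εA b • TensorProduct.map LinearMap.id h.left c := fun c b => by
    rw [T₁_twistedComul hY hA, counitRight_map, LinearMap.comp_id, eC.counitRight_T₁ hC mC,
      map_smul]
  apply le_antisymm
  · refine Submodule.span_le.2 ?_
    rintro _ ⟨c, b, hb, rfl⟩
    rw [key, hb, one_smul]
    exact ⟨c, rfl⟩
  · rintro _ ⟨c, rfl⟩
    -- An element `b` with `ε̄(b) = 1` is obtained by rescaling, unless `ε̄ = 0`; in that case `Y ⊗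
    -- A = 0`.
    by_cases h0 : ∀ x, tensorCounit εY εA x = 0
    · rw [eC.eq_zero_of_counit_eq_zero hC.nondegenerate h0 c, map_zero]
      exact zero_mem _
    · push Not at h0
      obtain ⟨b, hb⟩ := h0
      refine Submodule.subset_span ⟨c, (tensorCounit εY εA b)⁻¹ • b, ?_, ?_⟩
      · rw [map_smul, smul_eq_mul, inv_mul_cancel₀ hb]
      · rw [key, map_smul, smul_eq_mul, inv_mul_cancel₀ hb, one_smul]

end Smash

/-! ### The partial smash coproduct as the subalgebra `Y ⊗ hA`. -/

section PartialSmash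

variable {k : Type*} [Field k]
variable {A : Type*} [NonUnitalRing A] [Module k A] [SMulCommClass k A A] [IsScalarTower k A A]
variable {Y : Type*} [NonUnitalRing Y] [Module k Y] [SMulCommClass k Y Y] [IsScalarTower k Y Y]

/-- The inclusion `Y ⊗ B → Y ⊗ A`, for a subalgebra `B` of `A`. -/
def tensorInclusion (Y : Type*) [NonUnitalRing Y] [Module k Y] [SMulCommClass k Y Y]
    [IsScalarTower k Y Y] (B : NonUnitalSubalgebra k A) : Y ⊗[k] B →ₗ[k] Y ⊗[k] A :=
  TensorProduct.map LinearMap.id (inclusion B)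

theorem tensorInclusion_injective (B : NonUnitalSubalgebra k A) :
    Function.Injective (tensorInclusion Y B) :=
  TensorProduct.map_injective_of_flat_flat _ _ Function.injective_id Subtype.val_injective

theorem tensorInclusion_mul (B : NonUnitalSubalgebra k A) (x y : Y ⊗[k] B) :
    tensorInclusion Y B (x * y) = tensorInclusion Y B x * tensorInclusion Y B y := by
  induction x using TensorProduct.induction_on with
  | zero => simp
  | add x x' hx hx' => simp only [add_mul, map_add, hx, hx']
  | tmul a b =>
    induction y using TensorProduct.induction_on with
    | zero => simp
    | add y y' hy hy' => simp only [mul_add, map_add, hy, hy']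
    | tmul c d =>
      simp only [tensorInclusion, Algebra.TensorProduct.tmul_mul_tmul, TensorProduct.map_tmul]
      rfl

/-- The subalgebra `Y ⊗ B` of `Y ⊗ A`, for a subalgebra `B` of `A`. -/
def tensorSubalgebra (Y : Type*) [NonUnitalRing Y] [Module k Y] [SMulCommClass k Y Y]
    [IsScalarTower k Y Y] (B : NonUnitalSubalgebra k A) : NonUnitalSubalgebra k (Y ⊗[k] A) where
  toAddSubmonoid := (LinearMap.range (tensorInclusion Y B)).toAddSubmonoid
  smul_mem' c _ hx := (LinearMap.range (tensorInclusion Y B)).smul_mem c hx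
  mul_mem' := by
    rintro _ _ ⟨x, rfl⟩ ⟨y, rfl⟩
    exact ⟨x * y, tensorInclusion_mul B x y⟩

theorem tensorSubalgebra_toSubmodule (B : NonUnitalSubalgebra k A) :
    (tensorSubalgebra Y B).toSubmodule = LinearMap.range (tensorInclusion Y B) := rfl

/-- The isomorphism between `Y ⊗ B` and its image in `Y ⊗ A`. -/
noncomputable def tensorSubalgebraEquiv (Y : Type*) [NonUnitalRing Y] [Module k Y] [SMulCommClass k Y Y]
    [IsScalarTower k Y Y] (B : NonUnitalSubalgebra k A) : tensorSubalgebra Y B ≃ₗ[k] Y ⊗[k] B :=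
  (LinearEquiv.ofInjective (tensorInclusion Y B) (tensorInclusion_injective B)).symm

theorem tensorInclusion_equiv (B : NonUnitalSubalgebra k A) (x : tensorSubalgebra Y B) :
    tensorInclusion Y B (tensorSubalgebraEquiv Y B x) = inclusion (tensorSubalgebra Y B) x :=
  congrArg Subtype.val ((LinearEquiv.ofInjective (tensorInclusion Y B)
    (tensorInclusion_injective B)).apply_symm_apply x)

theorem tensorSubalgebraEquiv_mul (B : NonUnitalSubalgebra k A) (x y : tensorSubalgebra Y B) :
    tensorSubalgebraEquiv Y B (x * y) =
      tensorSubalgebraEquiv Y B x * tensorSubalgebraEquiv Y B y := by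
  apply tensorInclusion_injective B
  rw [tensorInclusion_mul, tensorInclusion_equiv, tensorInclusion_equiv, tensorInclusion_equiv]
  rfl

theorem map_tensorInclusion (B : NonUnitalSubalgebra k A) (u : Y ⊗[k] Y) (v : B ⊗[k] B) :
    TensorProduct.map (tensorInclusion Y B) (tensorInclusion Y B)
        (TensorProduct.tensorTensorTensorComm k Y Y B B (u ⊗ₜ v)) =
      TensorProduct.tensorTensorTensorComm k Y Y A A
        (u ⊗ₜ TensorProduct.map (inclusion B) (inclusion B) v) := by
  induction u, v using tensor_induction₂ with
  | zero_left v => simp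
  | zero_right u => simp
  | add_left u u' v h h' => simp only [TensorProduct.add_tmul, map_add, h, h']
  | add_right u v v' h h' => simp only [TensorProduct.tmul_add, map_add, h, h']
  | tmul y y' a a' => simp [tensorInclusion]

variable {ΔA : A →ₗ[k] Mult k (A ⊗[k] A)} {ΔY : Y →ₗ[k] Mult k (Y ⊗[k] Y)}
variable {B : NonUnitalSubalgebra k A} {ΔB : B →ₗ[k] Mult k (B ⊗[k] B)} {h : Mult k A}

theorem map_inclusion_of_fixed {f : A →ₗ[k] A} (hf : ∀ b, f (inclusion B b) = inclusion B b)
    (v : B ⊗[k] B) :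
    TensorProduct.map f LinearMap.id (TensorProduct.map (inclusion B) (inclusion B) v) =
      TensorProduct.map (inclusion B) (inclusion B) v := by
  induction v using TensorProduct.induction_on with
  | zero => simp
  | add x y hx hy => simp only [map_add, hx, hy]
  | tmul a b => simp [hf]

/-- On `Y ⊗ B`, where `h` acts as the identity of `B`, the comultiplication of the smash
coproduct is that of the tensor product. -/
theorem twistedComul_tensorInclusion (hB : IsRestriction ΔA B ΔB)
    (hl : ∀ b, h.left (inclusion B b) = inclusion B b)
    (hr : ∀ b, h.right (inclusion B b) = inclusion B b) (t : Y ⊗[k] B)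
    (z : (Y ⊗[k] B) ⊗[k] (Y ⊗[k] B)) :
    TensorProduct.map (tensorInclusion Y B) (tensorInclusion Y B)
        ((tensorComul ΔY ΔB t).left z) =
      (twistedComul ΔY ΔA h (tensorInclusion Y B t)).left
        (TensorProduct.map (tensorInclusion Y B) (tensorInclusion Y B) z) ∧
    TensorProduct.map (tensorInclusion Y B) (tensorInclusion Y B)
        ((tensorComul ΔY ΔB t).right z) =
      (twistedComul ΔY ΔA h (tensorInclusion Y B t)).right
        (TensorProduct.map (tensorInclusion Y B) (tensorInclusion Y B) z) := by
  obtain ⟨z, rfl⟩ := (TensorProduct.tensorTensorTensorComm k Y Y B B).surjective z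
  induction t using TensorProduct.induction_on with
  | zero =>
    have h₁ : ∀ x, (0 : Mult k ((Y ⊗[k] B) ⊗[k] (Y ⊗[k] B))).left x = 0 := fun _ => rfl
    have h₂ : ∀ x, (0 : Mult k ((Y ⊗[k] B) ⊗[k] (Y ⊗[k] B))).right x = 0 := fun _ => rfl
    have h₃ : ∀ x, (0 : Mult k ((Y ⊗[k] A) ⊗[k] (Y ⊗[k] A))).left x = 0 := fun _ => rfl
    have h₄ : ∀ x, (0 : Mult k ((Y ⊗[k] A) ⊗[k] (Y ⊗[k] A))).right x = 0 := fun _ => rfl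
    rw [map_zero, map_zero, map_zero, h₁, h₂, h₃, h₄, map_zero]
    exact ⟨rfl, rfl⟩
  | add t t' ht ht' =>
    simp only [map_add, left_add, right_add, ht.1, ht'.1, ht.2, ht'.2, and_self]
  | tmul y b =>
    induction z using TensorProduct.induction_on with
    | zero => simp
    | add z z' hz hz' => simp only [map_add, hz.1, hz'.1, hz.2, hz'.2, and_self]
    | tmul u v =>
      have hj : tensorInclusion Y B (y ⊗ₜ b) = y ⊗ₜ inclusion B b := rfl
      rw [hj, tensorComul_left, tensorComul_right, TensorProduct.map_tmul, TensorProduct.map_tmul,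
        map_tensorInclusion, map_tensorInclusion, map_tensorInclusion, twistedComul_left,
        twistedComul_right, (hB b v).1, (hB b v).2, map_inclusion_of_fixed hr]
      refine ⟨?_, rfl⟩
      have := map_inclusion_of_fixed hl ((ΔB b).left v)
      rw [(hB b v).1] at this
      exact congrArg _ (congrArg _ this.symm)

/-- An isomorphism is the case `e = 1` of a direct factor, so the results on direct factors also
transport the bialgebra structure of `Y ⊗ B` to its image in `Y ⊗ A`. -/
theorem isCorner_tensorSubalgebraEquiv (B : NonUnitalSubalgebra k A) :
    IsCorner (tensorSubalgebraEquiv Y B).toLinearMap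
      (tensorSubalgebraEquiv Y B).symm.toLinearMap :=
  isCorner_of_equiv _ (tensorSubalgebraEquiv_mul B)

theorem isRestriction_tensorSubalgebra (hn : IsNondegenerateAlg (Y ⊗[k] B))
    (hB : IsRestriction ΔA B ΔB)
    (hl : ∀ b, h.left (inclusion B b) = inclusion B b)
    (hr : ∀ b, h.right (inclusion B b) = inclusion B b) :
    IsRestriction (twistedComul ΔY ΔA h) (tensorSubalgebra Y B)
      ((isCorner_tensorSubalgebraEquiv B).restrictComul (tensorComul ΔY ΔB)) := by
  have hincl : inclusion (tensorSubalgebra Y B) =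
      tensorInclusion Y B ∘ₗ (tensorSubalgebraEquiv Y B).toLinearMap :=
    LinearMap.ext fun x => (tensorInclusion_equiv B x).symm
  have hs : ∀ s : tensorSubalgebra Y B,
      (s : Y ⊗[k] A) = tensorInclusion Y B (tensorSubalgebraEquiv Y B s) :=
    fun s => (tensorInclusion_equiv B s).symm
  intro s x
  rw [hincl, TensorProduct.map_comp, LinearMap.comp_apply, LinearMap.comp_apply,
    LinearMap.comp_apply, (isCorner_tensorSubalgebraEquiv B).map_restrictComul_left hn,
    (isCorner_tensorSubalgebraEquiv B).map_restrictComul_right hn, hs]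
  exact twistedComul_tensorInclusion hB hl hr _ _

/-- Idempotency is needed for one inclusion only: elements of `Y ⊗ hA` are fixed by `1 ⊗ h`, hence
lie in its range. -/
theorem range_tensorInclusion_leftIdeal (hn : IsNondegenerateAlg A) (h : Mult k A)
    (hi : ∀ a, h.left (h.left a) = h.left a) :
    LinearMap.range (tensorInclusion Y (leftIdeal hn h)) =
      LinearMap.range (TensorProduct.map LinearMap.id h.left : Y ⊗[k] A →ₗ[k] Y ⊗[k] A) := by
  apply le_antisymm
  · rintro _ ⟨x, rfl⟩
    refine ⟨tensorInclusion Y _ x, ?_⟩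
    rw [tensorInclusion, ← LinearMap.comp_apply, ← TensorProduct.map_comp]
    congr 2
    exact LinearMap.ext fun b => left_inclusion_leftIdeal hi b
  · rintro _ ⟨x, rfl⟩
    refine ⟨TensorProduct.map LinearMap.id (leftIdealProj hn h) x, ?_⟩
    rw [tensorInclusion, ← LinearMap.comp_apply, ← TensorProduct.map_comp,
      inclusion_leftIdealProj, LinearMap.comp_id]

end PartialSmash

end MultHopf

/-! ### Proof of the proposition. -/

open MultHopf MultHopf.Mult in
set_option maxHeartbeats 1000000 in
theorem mainTheorem10 {k : Type*} [Field k]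
    {A : Type*} [NonUnitalRing A] [Module k A] [SMulCommClass k A A] [IsScalarTower k A A]
    {Y : Type*} [NonUnitalRing Y] [Module k Y] [SMulCommClass k Y Y] [IsScalarTower k Y Y]
    (ΔA : A →ₗ[k] MultHopf.Mult k (A ⊗[k] A)) (ΔY : Y →ₗ[k] MultHopf.Mult k (Y ⊗[k] Y))
    (hA : MultHopf.IsRegularMultiplierHopf ΔA) (hY : MultHopf.IsRegularMultiplierHopf ΔY)
    (hcomm : ∀ a b : A, a * b = b * a)
    (h : MultHopf.Mult k A)
    (hε : MultHopf.Mult.extend (MultHopf.Mult.incl ∘ₗ MultHopf.counit ΔA) h =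
      (1 : MultHopf.Mult k k))
    (hΔ : MultHopf.Mult.tmul h h = MultHopf.Mult.tmul h 1 * MultHopf.Mult.extend ΔA h)
    (hΔ' : MultHopf.Mult.tmul h h = MultHopf.Mult.tmul 1 h * MultHopf.Mult.extend ΔA h) :
    MultHopf.IsMultiplierHopfSubalgebra ΔA (MultHopf.Mult.leftIdeal hA.nondegenerate h) ∧
    MultHopf.IsSmashComul ΔY ΔA (MultHopf.constCoaction Y h)
      (MultHopf.smashComul ΔY ΔA (MultHopf.constCoaction Y h)) ∧
    ∃ S : NonUnitalSubalgebra k (Y ⊗[k] A),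
      S.toSubmodule = MultHopf.partialSmash ΔY ΔA (MultHopf.constCoaction Y h) ∧
      MultHopf.IsRestriction (MultHopf.smashComul ΔY ΔA (MultHopf.constCoaction Y h)) S
        (MultHopf.restrictComul (MultHopf.smashComul ΔY ΔA (MultHopf.constCoaction Y h)) S) ∧
      MultHopf.IsCounitaryMultiplierBialgebra
        (MultHopf.restrictComul (MultHopf.smashComul ΔY ΔA (MultHopf.constCoaction Y h)) S)
        (MultHopf.tensorCounit (MultHopf.counit ΔY) (MultHopf.counit ΔA) ∘ₗ
          MultHopf.inclusion S) ∧
      MultHopf.IsCounitaryMultiplierBialgebra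
        (MultHopf.tensorComul ΔY
          (MultHopf.restrictComul ΔA (MultHopf.Mult.leftIdeal hA.nondegenerate h)))
        (MultHopf.tensorCounit (MultHopf.counit ΔY) (MultHopf.counit
          (MultHopf.restrictComul ΔA (MultHopf.Mult.leftIdeal hA.nondegenerate h)))) ∧
      MultHopf.CounitaryIsomorphic
        (MultHopf.restrictComul (MultHopf.smashComul ΔY ΔA (MultHopf.constCoaction Y h)) S)
        (MultHopf.tensorCounit (MultHopf.counit ΔY) (MultHopf.counit ΔA) ∘ₗ
          MultHopf.inclusion S)
        (MultHopf.tensorComul ΔY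
          (MultHopf.restrictComul ΔA (MultHopf.Mult.leftIdeal hA.nondegenerate h)))
        (MultHopf.tensorCounit (MultHopf.counit ΔY) (MultHopf.counit
          (MultHopf.restrictComul ΔA (MultHopf.Mult.leftIdeal hA.nondegenerate h)))) := by
  have hn := hA.nondegenerate
  have eA := hA.isHopfCounit_counit
  have eY := hY.isHopfCounit_counit
  have hg := isGroupLikeProj_of_extend hn eA hε hΔ hΔ'
  have hi := hg.left_left hA.covered eA
  set B := leftIdeal hA.nondegenerate h with hBdef
  have hl : ∀ b, h.left (inclusion B b) = inclusion B b := left_inclusion_leftIdeal hi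
  have hr : ∀ b, h.right (inclusion B b) = inclusion B b := fun b => by
    rw [right_eq_left hn hcomm, hl]
  have cB : IsCorner (inclusion B) (leftIdealProj hn h) := isCorner_leftIdeal hi hcomm
  have kB : IsCorner.IsCompatible (inclusion B) (leftIdealProj hn h) ΔA := hg.isCompatible hcomm
  have rB' : IsRestriction ΔA B (cB.restrictComul ΔA) := fun s x =>
    ⟨cB.map_restrictComul_left hn s x, cB.map_restrictComul_right hn s x⟩
  have HB : IsMultiplierHopf (restrictComul ΔA B) := by
    rw [rB'.restrictComul_eq]
    exact cB.isMultiplierHopf hA.toIsMultiplierHopf kB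
  have rB : IsRestriction ΔA B (restrictComul ΔA B) := by
    rw [rB'.restrictComul_eq]
    exact rB'
  -- The counit of `hA` is chosen independently of that of `A`; by uniqueness it is the restriction
  -- of `ε_A`. This is what makes the isomorphism respect the counits.
  have cuB : counit (restrictComul ΔA B) = counit ΔA ∘ₗ inclusion B := by
    apply HB.counit_unique
    rw [rB'.restrictComul_eq]
    exact cB.isHopfCounit hA.covered kB eA
  have HC : IsMultiplierBialgebra (tensorComul ΔY (restrictComul ΔA B)) :=
    hY.toIsMultiplierBialgebra.tensor HB.toIsMultiplierBialgebra
  have eC : IsHopfCounit (tensorComul ΔY (restrictComul ΔA B))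
      (tensorCounit (counit ΔY) (counit (restrictComul ΔA B))) :=
    eY.tensor hY.covered HB.covered HB.isHopfCounit_counit
  have mC := tensorCounit_mul hY.counit_mul HB.counit_mul
  have hD : smashComul ΔY ΔA (constCoaction Y h) = twistedComul ΔY ΔA h :=
    (isSmashComul_twistedComul hY.covered hA.covered h).smashComul_eq
  have cS := isCorner_tensorSubalgebraEquiv (Y := Y) B
  have kS := IsCorner.isCompatible_of_equiv (tensorSubalgebraEquiv Y B)
    (tensorComul ΔY (restrictComul ΔA B))
  have rS : IsRestriction (twistedComul ΔY ΔA h) (tensorSubalgebra Y B)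
      (cS.restrictComul (tensorComul ΔY (restrictComul ΔA B))) :=
    isRestriction_tensorSubalgebra HC.nondegenerate rB hl hr
  have hcu : ∀ s : tensorSubalgebra Y B,
      tensorCounit (counit ΔY) (counit (restrictComul ΔA B)) (tensorSubalgebraEquiv Y B s) =
        tensorCounit (counit ΔY) (counit ΔA) (inclusion _ s) := fun s => by
    rw [← tensorInclusion_equiv, cuB]
    generalize tensorSubalgebraEquiv Y B s = t
    induction t using TensorProduct.induction_on with
    | zero => simp
    | add x y hx hy => simp only [map_add, hx, hy]
    | tmul y b => rfl
  have eS : IsHopfCounit (cS.restrictComul (tensorComul ΔY (restrictComul ΔA B)))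
      (tensorCounit (counit ΔY) (counit ΔA) ∘ₗ inclusion (tensorSubalgebra Y B)) := by
    have := cS.isHopfCounit HC.covered kS eC
    rwa [show tensorCounit (counit ΔY) (counit (restrictComul ΔA B)) ∘ₗ
        (tensorSubalgebraEquiv Y B).toLinearMap =
      tensorCounit (counit ΔY) (counit ΔA) ∘ₗ inclusion (tensorSubalgebra Y B) from
      LinearMap.ext hcu] at this
  rw [hD]
  refine ⟨⟨rB, HB⟩, isSmashComul_twistedComul hY.covered hA.covered h, tensorSubalgebra Y B,
    ?_, ?_⟩
  · rw [tensorSubalgebra_toSubmodule, partialSmash, hD,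
      counitalPart_twistedComul hY.covered hA.covered eY eA hY.counit_mul hA.counit_mul,
      range_tensorInclusion_leftIdeal hn h hi]
  rw [rS.restrictComul_eq]
  refine ⟨rS, eS.counitary (cS.isMultiplierBialgebra HC kS) fun s t => ?_,
    eC.counitary HC mC, tensorSubalgebraEquiv Y B, tensorSubalgebraEquiv_mul B,
    fun s x => cS.map_restrictComul_left HC.nondegenerate s x,
    fun s x => cS.map_restrictComul_right HC.nondegenerate s x, hcu⟩
  -- Multiplicativity of the restricted `ε̄` is transported from `Y ⊗ hA` along the isomorphism.
  simp only [LinearMap.comp_apply]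
  rw [← hcu, ← hcu, ← hcu, tensorSubalgebraEquiv_mul, mC]
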